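/- Let $v_1,v_2,v_3\in\mathbb R^2$ be distinct and non-collinear, let $\Delta=\mathrm{co}\{v_1,v_2,v_3\}$ be the triangle they span, and let $c$ be its circumcenter, i.e. the unique point with $|v_1-c|=|v_2-c|=|v_3-c|$. Let $\varphi(y)=\min_{i}v_i\cdot y$ be the initial velocity potential. For $t>0$ let $u_t(x)=\inf_y\big(\frac{|x-y|^2}{2t}+\varphi(y)\big)$ (a concave function), with differential $\partial u_t(x)=\{q\in\mathbb R^2:\ u_t(z)\le u_t(x)+q\cdot(z-x)\ \text{for all }z\}$. For $t\ge0$ let $\psi_t(y)=\frac12|y|^2+t\varphi(y)$, and let $T_t=\nabla\psi_t^{**}$ be the convexified transport map, where $\psi_t^{**}$ is the second Legendre transform of $\psi_t$. For $\varepsilon>0$ let $u^\varepsilon_t(x)=-\varepsilon\log\Big(\frac1{2\pi\varepsilon t}\int_{\mathbb R^2}\exp\big(-\frac{|x-y|^2}{2\varepsilon t}-\frac{\varphi(y)}{\varepsilon}\big)\,dy\Big)$ be the solution of $\partial_tu^\varepsilon+\frac12|\nabla u^\varepsilon|^2=\frac\varepsilon2\Delta u^\varepsilon$, $u^\varepsilon_0=\varphi$,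 and let $X^\varepsilon$ be the flow $\partial_tX^\varepsilon_t(y)=\nabla u^\varepsilon_t(X^\varepsilon_t(y))$ for $t>0$, with $t\mapsto X^\varepsilon_t(y)$ continuous on $[0,\infty)$ and $X^\varepsilon_0(y)=y$. Let $X_t(y)=\lim_{\varepsilon\to0^+}X^\varepsilon_t(y)$ for $t\ge 0$ be the Lagrangian flow of the adhesion model. (The flows $X^\varepsilon$ and their limit $X$ exist.) For $t>0$ and $x\in\mathbb R^2$ define the transport velocity $$V_t(x)=\begin{cases}v_i & \text{if } |x-tv_i|>|x-tv_j|\ \text{for all }j\ne i,\\ \tfrac12(v_i+v_j) & \text{if } v_i\cdot(x-tc)=v_j\cdot(x-tc)<v_k\cdot(x-tc),\ \{i,j,k\}=\{1,2,3\},\\ c & \text{if } x=tc.\end{cases}$$ Then the following are equivalent: (i) $c\in\Delta$. (ii) $V_t(x)\in\partial u_t(x)$ for all $t>0$ and all $x\in\mathbb R^2$. (iii) $T_t(y)=X_t(y)$ for all $t\ge0$ and all $y\in\mathbb R^2$. (iv) The maps $T_t$ are sticky: whenever $0\le s\le t$ and $T_s(y)=T_s(z)$, also $T_t(y)=T_t(z)$.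 (v) For every $t>0$, $V_t$ satisfies a one-sided Lipschitz condition: there is $\lambda\ge0$ with $(V_t(x)-V_t(z))\cdot(x-z)\le\lambda|x-z|^2$ for all $x,z\in\mathbb R^2$. -/

import Mathlib

namespace ThreeSector

/-- The Euclidean plane. -/
abbrev Plane : Type := EuclideanSpace ℝ (Fin 2)

/-! Potentials. -/

/-- The initial velocity potential `φ(y) = min_i v_i · y`. -/
noncomputable def phi (v : Fin 3 → Plane) (y : Plane) : ℝ :=
  ⨅ i : Fin 3, inner ℝ (v i) y

/-- The velocity potential `u_t` of the inviscid problem (Hopf-Lax formula), for `t > 0`. -/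
noncomputable def u (v : Fin 3 → Plane) (t : ℝ) (x : Plane) : ℝ :=
  ⨅ y : Plane, (‖x - y‖ ^ 2 / (2 * t) + phi v y)

/-- The free-streaming potential `ψ_t(y) = |y|²/2 + t φ(y)`. -/
noncomputable def psi (v : Fin 3 → Plane) (t : ℝ) (y : Plane) : ℝ :=
  ‖y‖ ^ 2 / 2 + t * phi v y

/-- The Legendre transform `f*(x) = sup_y (x · y - f(y))`. It is applied below only to continuous
functions of superlinear growth, for which the supremum is finite. -/
noncomputable def legendre (f : Plane → ℝ) (x : Plane) : ℝ :=
  ⨆ y : Plane, (inner ℝ x y - f y)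

/-- The convexified transport map `T_t = ∇ψ_t**`. -/
noncomputable def T (v : Fin 3 → Plane) (t : ℝ) (y : Plane) : Plane :=
  gradient (legendre (legendre (psi v t))) y

/-- The differential at `x` of a `lam`-concave function `f`: the slopes at `x` of the paraboloids
with Hessian `lam • I` that touch the graph of `f` at `x` from above. -/
def differential (lam : ℝ) (f : Plane → ℝ) (x : Plane) : Set Plane :=
  {q | ∀ z, f z ≤ f x + inner ℝ q (z - x) + lam / 2 * ‖z - x‖ ^ 2}

/-! The Lagrangian flow of the adhesion model, as a zero-viscosity limit. -/

/-- The viscous velocity potential `u^ε_t` (Cole-Hopf formula in dimension two): the solution of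
`∂_t u + |∇u|²/2 = (ε/2) Δu` with initial data `φ`. -/
noncomputable def uVisc (v : Fin 3 → Plane) (ε t : ℝ) (x : Plane) : ℝ :=
  -ε * Real.log ((2 * Real.pi * ε * t)⁻¹ *
    ∫ y : Plane, Real.exp (-(‖x - y‖ ^ 2) / (2 * ε * t) - phi v y / ε))

/-- `Y t y` is the flow of the viscous velocity field `v^ε = ∇u^ε`: `∂_t Y = v^ε(Y, t)` for
`t > 0`, and each path is continuous on `[0, ∞)` with `Y 0 y = y`. -/
def IsViscousFlow (v : Fin 3 → Plane) (ε : ℝ) (Y : ℝ → Plane → Plane) : Prop :=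
  ∀ y : Plane, Y 0 y = y ∧ ContinuousOn (fun t => Y t y) (Set.Ici 0) ∧
    ∀ t : ℝ, 0 < t → HasDerivAt (fun s => Y s y) (gradient (uVisc v ε t) (Y t y)) t

/-- `X t y` (`t ≥ 0`) is the limit, as `ε → 0+`, of the flows of the viscous velocity fields. -/
def IsLagrangianFlow (v : Fin 3 → Plane) (X : ℝ → Plane → Plane) : Prop :=
  ∃ Y : ℝ → ℝ → Plane → Plane, (∀ ε : ℝ, 0 < ε → IsViscousFlow v ε (Y ε)) ∧
    ∀ t : ℝ, 0 ≤ t → ∀ y : Plane,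
      Filter.Tendsto (fun ε => Y ε t y) (nhdsWithin 0 (Set.Ioi 0)) (nhds (X t y))

/-! The transport velocity. -/

/-- The circumcenter of the triangle with vertices `v_i`. -/
noncomputable def center (v : Fin 3 → Plane) (hv : AffineIndependent ℝ v) : Plane :=
  (⟨v, hv⟩ : Affine.Simplex ℝ Plane 2).circumcenter

/-- The open sector `A_i^t` on which `|x - t v_i|²` is the largest of the three. -/
def sector (v : Fin 3 → Plane) (t : ℝ) (i : Fin 3) : Set Plane :=
  {x | ∀ j, j ≠ i → ‖x - t • v j‖ ^ 2 < ‖x - t • v i‖ ^ 2}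

/-- The ray `R_ij^0` along which `v_i · y = v_j · y < v_k · y` for the third index `k`. -/
def ray (v : Fin 3 → Plane) (i j : Fin 3) : Set Plane :=
  {y | inner ℝ (v i) y = inner ℝ (v j) y ∧
    ∀ k, k ≠ i → k ≠ j → inner ℝ (v i) y < inner ℝ (v k) y}

/-- The shifted ray `R_ij^t = R_ij^0 + t c`. -/
def rayAt (v : Fin 3 → Plane) (c : Plane) (t : ℝ) (i j : Fin 3) : Set Plane :=
  {x | x - t • c ∈ ray v i j}

open Classical in
/-- The transport velocity `V_t`, with `c` the circumcenter: it is `v_i` on the sector `A_i^t`,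
`(v_i + v_j)/2` on the ray `R_ij^t`, and `c` at the one remaining point `x = t c`. -/
noncomputable def V (v : Fin 3 → Plane) (c : Plane) (t : ℝ) (x : Plane) : Plane :=
  if x ∈ sector v t 0 then v 0
  else if x ∈ sector v t 1 then v 1
  else if x ∈ sector v t 2 then v 2
  else if x ∈ rayAt v c t 0 1 then midpoint ℝ (v 0) (v 1)
  else if x ∈ rayAt v c t 1 2 then midpoint ℝ (v 1) (v 2)
  else if x ∈ rayAt v c t 2 0 then midpoint ℝ (v 2) (v 0)
  else c

/-- A family of maps `T_t` (`t ≥ 0`) is sticky: points that have met never separate. -/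
def IsSticky (F : ℝ → Plane → Plane) : Prop :=
  ∀ s t : ℝ, 0 ≤ s → s ≤ t → ∀ y z : Plane, F s y = F s z → F t y = F t z

/-- The one-sided Lipschitz condition for a vector field on the plane. -/
def OneSidedLipschitz (W : Plane → Plane) : Prop :=
  ∃ lam : ℝ, 0 ≤ lam ∧ ∀ x z : Plane, inner ℝ (W x - W z) (x - z) ≤ lam * ‖x - z‖ ^ 2

end ThreeSector

/-!
All the velocities involved (`∇u^ε_t`, and `V_t` when `c ∈ Δ`) are supergradients of concave
potentials, so trajectories contract; supergradients of potentials at uniform distance `δ` keep the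
trajectories within `O(√(δt))` of each other. As `φ` is a minimum of three linear functions,
`u_t - ε log 3 ≤ u^ε_t ≤ u_t`. Hence the viscous flows form a Cauchy family as `ε → 0`, and any
trajectory moving with a velocity in `∂u_t` is a trajectory of the Lagrangian flow.

The point `c` enters through its equidistance from the `v i`: it turns `u_t` into `φ(· - tc)` plus a
constant, so `∂u_t(x)` contains the face of `Δ` on which `⟪·, x - tc⟫` is minimal, and
`T_t(y) = y + tq` with `q` in that face for `x = T_t(y)`. If `c ∈ Δ`, then `V_t(x)` lies in the face
and `V_t(x) - c` is orthogonal to it, which makes `V_t(T_t(y))` the right derivative of `T_t(y)`.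
Conversely, if `T` is sticky, the projection of `c` to `Δ` is seen to be `c`, and a one-sided
Lipschitz bound near `x = tc` gives `φ ≤ ⟪c, ·⟫`, that is, `c ∈ Δ`.
-/

namespace ThreeSector

open Set Filter Topology MeasureTheory
open scoped NNReal

/-! ### Supergradients and convex hulls in a real inner product space -/

section Supergradient

variable {E : Type*} [NormedAddCommGroup E] [InnerProductSpace ℝ E]

/-- The superdifferential of a real function on an inner product space: the slopes of the affine
functions that touch the graph of `f` at `x` from above. -/
def superdifferential (f : E → ℝ) (x : E) : Set E :=
  {q | ∀ z, f z ≤ f x + inner ℝ q (z - x)}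

lemma differential_zero (f : Plane → ℝ) (x : Plane) :
    differential 0 f x = superdifferential f x := by
  simp [differential, superdifferential]

lemma inner_sub_le_of_mem_superdifferential {f g : E → ℝ} {p q x z : E} {a b : ℝ}
    (hp : p ∈ superdifferential f x) (hq : q ∈ superdifferential g z)
    (hgf : ∀ y, g y ≤ f y + a) (hfg : ∀ y, f y ≤ g y + b) : inner ℝ (p - q) (x - z) ≤ a + b := by
  have hpz := hp z
  rw [← neg_sub x z, inner_neg_right] at hpz
  rw [inner_sub_left]
  linarith [hq x, hgf z, hfg x]

lemma inner_sub_nonpos_of_mem_superdifferential {f : E → ℝ} {p q x z : E}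
    (hp : p ∈ superdifferential f x) (hq : q ∈ superdifferential f z) :
    inner ℝ (p - q) (x - z) ≤ 0 := by
  simpa using inner_sub_le_of_mem_superdifferential (a := 0) (b := 0) hp hq (by simp) (by simp)

lemma hasGradientAt_of_mem_superdifferential [CompleteSpace E] {f : E → ℝ} {q : E → E}
    (hq : ∀ x, q x ∈ superdifferential f x) {x : E} (hqx : ContinuousAt q x) :
    HasGradientAt f (q x) x := by
  rw [hasGradientAt_iff_isLittleO, Asymptotics.isLittleO_iff]
  intro e he
  filter_upwards [Metric.continuousAt_iff'.1 hqx e he] with z hz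
  have upper : f z - f x - inner ℝ (q x) (z - x) ≤ 0 := by linarith [hq x z]
  have lower : inner ℝ (q z - q x) (z - x) ≤ f z - f x - inner ℝ (q x) (z - x) := by
    have hzx := hq z x
    rw [← neg_sub z x, inner_neg_right] at hzx
    rw [inner_sub_left]
    linarith
  have small : |inner ℝ (q z - q x) (z - x)| ≤ e * ‖z - x‖ :=
    (abs_real_inner_le_norm _ _).trans
      (mul_le_mul_of_nonneg_right ((dist_eq_norm (q z) (q x)).symm.trans_lt hz).le (norm_nonneg _))
  rw [Real.norm_eq_abs, abs_le]
  constructor <;> linarith [neg_le_of_abs_le small, norm_nonneg (z - x)]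

lemma smul_mem_superdifferential {f : E → ℝ} {q x : E} {r : ℝ} (hr : 0 ≤ r)
    (hq : q ∈ superdifferential f x) : r • q ∈ superdifferential (fun y => r * f y) x := fun z => by
  rw [real_inner_smul_left, ← mul_add]
  exact mul_le_mul_of_nonneg_left (hq z) hr

lemma le_inner_of_mem_convexHull {s : Set E} {q w : E} {a : ℝ} (hq : q ∈ convexHull ℝ s)
    (hs : ∀ p ∈ s, a ≤ inner ℝ p w) : a ≤ inner ℝ q w :=
  convexHull_min hs (convex_halfSpace_ge (f := fun p : E => inner ℝ p w)
    ⟨fun _ _ => inner_add_left _ _ _, fun _ _ => real_inner_smul_left _ _ _⟩ a) hq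

lemma exists_mem_forall_inner_sub_nonneg {K : Set E} (hne : K.Nonempty) (hK : IsComplete K)
    (hconv : Convex ℝ K) (p : E) : ∃ q ∈ K, ∀ k ∈ K, 0 ≤ inner ℝ (q - p) (k - q) := by
  obtain ⟨q, hq, hmin⟩ := exists_norm_eq_iInf_of_complete_convex hne hK hconv p
  refine ⟨q, hq, fun k hk => ?_⟩
  rw [← neg_sub p q, inner_neg_left, neg_nonneg]
  exact (norm_eq_iInf_iff_real_inner_le_zero hconv hq).1 hmin k hk

lemma eq_zero_of_forall_inner_eq {s : Set E} (hs : vectorSpan ℝ s = ⊤) {w : E}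
    (h : ∀ p ∈ s, ∀ q ∈ s, inner ℝ p w = (inner ℝ q w : ℝ)) : w = 0 := by
  have hle : vectorSpan ℝ s ≤ (Submodule.span ℝ {w})ᗮ := Submodule.span_le.2 <| by
    rintro _ ⟨p, hp, q, hq, rfl⟩
    refine Submodule.mem_orthogonal_singleton_iff_inner_left.2 ?_
    simp only [vsub_eq_sub, inner_sub_left, h p hp q hq, sub_self]
  have hw : w ∈ (Submodule.span ℝ {w})ᗮ := hle (hs ▸ Submodule.mem_top)
  exact inner_self_eq_zero.1 (Submodule.mem_orthogonal_singleton_iff_inner_left.1 hw)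

end Supergradient

/-! ### Trajectories with dissipative velocities -/

section Trajectory

variable {E : Type*} [NormedAddCommGroup E] [InnerProductSpace ℝ E]

lemma le_add_mul_of_hasDerivWithinAt_le {f f' : ℝ → ℝ} {a b C : ℝ} (hab : a ≤ b)
    (hf : ContinuousOn f (Icc a b)) (hf' : ∀ t ∈ Ioo a b, HasDerivWithinAt f (f' t) (Ici t) t)
    (hC : ∀ t ∈ Ioo a b, f' t ≤ C) : f b ≤ f a + C * (b - a) := by
  rcases hab.eq_or_lt with rfl | hlt
  · simp
  have from_interior : ∀ s ∈ Ioo a b, f b ≤ f s + C * (b - s) := fun s hs => by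
    have hsub : Ico s b ⊆ Ioo a b := fun t ht => ⟨hs.1.trans_le ht.1, ht.2⟩
    refine image_le_of_deriv_right_le_deriv_boundary
      (B := fun t => f s + C * (t - s)) (B' := fun _ => C)
      (hf.mono (Icc_subset_Icc_left hs.1.le)) (fun t ht => hf' t (hsub ht)) (by simp)
      (by fun_prop) (fun t _ => ?_) (fun t ht => hC t (hsub ht)) (right_mem_Icc.2 hs.2.le)
    simpa using ((((hasDerivAt_id t).sub_const s).const_mul C).const_add (f s)).hasDerivWithinAt
  have hlim : Tendsto (fun s => f s + C * (b - s)) (𝓝[Ioo a b] a) (𝓝 (f a + C * (b - a))) :=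
    ((hf a (left_mem_Icc.2 hab)).mono Ioo_subset_Icc_self).add
      (by fun_prop : ContinuousWithinAt (fun s => C * (b - s)) (Ioo a b) a)
  have : (𝓝[Ioo a b] a).NeBot := left_nhdsWithin_Ioo_neBot hlt
  exact ge_of_tendsto hlim (eventually_mem_nhdsWithin.mono from_interior)

lemma norm_sub_sq_le_of_inner_deriv_le {α β p q : ℝ → E} {a b C : ℝ} (hab : a ≤ b)
    (hα : ContinuousOn α (Icc a b)) (hβ : ContinuousOn β (Icc a b))
    (hα' : ∀ t ∈ Ioo a b, HasDerivWithinAt α (p t) (Ici t) t)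
    (hβ' : ∀ t ∈ Ioo a b, HasDerivWithinAt β (q t) (Ici t) t)
    (hC : ∀ t ∈ Ioo a b, inner ℝ (p t - q t) (α t - β t) ≤ C) :
    ‖α b - β b‖ ^ 2 ≤ ‖α a - β a‖ ^ 2 + 2 * C * (b - a) := by
  refine le_add_mul_of_hasDerivWithinAt_le (f := fun t => ‖α t - β t‖ ^ 2) hab
    ((hα.sub hβ).norm.pow 2) (fun t ht => ((hα' t ht).sub (hβ' t ht)).norm_sq) fun t ht => ?_
  rw [Pi.sub_apply, real_inner_comm]
  linarith [hC t ht]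

lemma norm_sub_le_of_inner_deriv_nonpos {α β p q : ℝ → E} {a b : ℝ} (hab : a ≤ b)
    (hα : ContinuousOn α (Icc a b)) (hβ : ContinuousOn β (Icc a b))
    (hα' : ∀ t ∈ Ioo a b, HasDerivWithinAt α (p t) (Ici t) t)
    (hβ' : ∀ t ∈ Ioo a b, HasDerivWithinAt β (q t) (Ici t) t)
    (hpq : ∀ t ∈ Ioo a b, inner ℝ (p t - q t) (α t - β t) ≤ 0) :
    ‖α b - β b‖ ≤ ‖α a - β a‖ := by
  refine le_of_sq_le_sq ?_ (norm_nonneg _)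
  simpa using norm_sub_sq_le_of_inner_deriv_le hab hα hβ hα' hβ' hpq

lemma exists_tendsto_nhdsGT_of_dist_le {X : Type*} [PseudoMetricSpace X] [CompleteSpace X]
    {f : ℝ → X} {g : ℝ → ℝ} {a : ℝ} (hg : Tendsto g (𝓝[>] a) (𝓝 0))
    (hf : ∀ᶠ d in 𝓝[>] a, ∀ s ∈ Ioc a d, dist (f s) (f d) ≤ g d) :
    ∃ x, Tendsto f (𝓝[>] a) (𝓝 x) := by
  refine cauchy_map_iff_exists_tendsto.1 (Metric.cauchy_iff.2 ⟨inferInstance, fun e he => ?_⟩)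
  obtain ⟨d, hgd, hfd, hd⟩ := ((hg.eventually_lt_const (half_pos he)).and
    (hf.and self_mem_nhdsWithin)).exists
  refine ⟨f '' Ioc a d, image_mem_map (Ioc_mem_nhdsGT hd), ?_⟩
  rintro _ ⟨r, hr, rfl⟩ _ ⟨s, hs, rfl⟩
  linarith [dist_triangle_right (f r) (f s) (f d), hfd r hr, hfd s hs]

end Trajectory

/-! ### Differential equations with a dissipative field singular at time zero -/

section DissipativeField

variable {E : Type*} [NormedAddCommGroup E] [InnerProductSpace ℝ E]

/-- A bounded dissipative time-dependent vector field on positive times, regular enough for the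
Picard-Lindelöf theorem away from time zero. Nothing is required as `t → 0⁺` besides the bound. -/
structure IsDissipativeField (b : ℝ → E → E) (M : ℝ≥0) : Prop where
  norm_le : ∀ ⦃t⦄, 0 < t → ∀ x, ‖b t x‖ ≤ M
  inner_sub_nonpos : ∀ ⦃t⦄, 0 < t → ∀ x z, inner ℝ (b t x - b t z) (x - z) ≤ 0
  continuousOn : ∀ x, ContinuousOn (fun t => b t x) (Ioi 0)
  lipschitzOnWith : ∀ ⦃a⦄, 0 < a → ∀ c R, ∃ K : ℝ≥0, ∀ t ∈ Icc a c,
    LipschitzOnWith K (b t) (Metric.closedBall 0 R)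

namespace IsDissipativeField

variable {b : ℝ → E → E} {M : ℝ≥0} {α β : ℝ → E} {a c : ℝ}

lemma lipschitzOnWith_of_isIntegralCurveOn (hb : IsDissipativeField b M) (ha : 0 < a)
    (hα : IsIntegralCurveOn α b (Icc a c)) : LipschitzOnWith M α (Icc a c) :=
  (convex_Icc a c).lipschitzOnWith_of_nnnorm_hasDerivWithin_le hα
    fun _ ht => hb.norm_le (ha.trans_le ht.1) _

lemma norm_sub_le_of_isIntegralCurveOn (hb : IsDissipativeField b M) (ha : 0 < a)
    (hα : IsIntegralCurveOn α b (Icc a c)) (hβ : IsIntegralCurveOn β b (Icc a c))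
    {t : ℝ} (ht : t ∈ Icc a c) : ‖α t - β t‖ ≤ ‖α a - β a‖ := by
  have hsub : Icc a t ⊆ Icc a c := Icc_subset_Icc_right ht.2
  have right_deriv : ∀ {γ : ℝ → E}, IsIntegralCurveOn γ b (Icc a c) →
      ∀ s ∈ Ioo a t, HasDerivWithinAt γ (b s (γ s)) (Ici s) s := fun hγ s hs =>
    ((hγ s (hsub (Ioo_subset_Icc_self hs))).hasDerivAt
      (Icc_mem_nhds hs.1 (hs.2.trans_le ht.2))).hasDerivWithinAt
  exact norm_sub_le_of_inner_deriv_nonpos ht.1 (hα.continuousOn.mono hsub)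
    (hβ.continuousOn.mono hsub) (right_deriv hα) (right_deriv hβ)
    fun s hs => hb.inner_sub_nonpos (ha.trans hs.1) _ _

lemma exists_isIntegralCurveOn [CompleteSpace E] (hb : IsDissipativeField b M) (ha : 0 < a)
    (hac : a ≤ c) (x : E) : ∃ α, α a = x ∧ IsIntegralCurveOn α b (Icc a c) := by
  let r : ℝ≥0 := M * Real.toNNReal (c - a)
  obtain ⟨K, hK⟩ := hb.lipschitzOnWith ha c (‖x‖ + r)
  have hball : Metric.closedBall x r ⊆ Metric.closedBall 0 (‖x‖ + r) :=
    Metric.closedBall_subset_closedBall' (by rw [dist_zero_right, add_comm])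
  have hPL : IsPicardLindelof b (⟨a, left_mem_Icc.2 hac⟩ : Icc a c) x r 0 M K :=
    { lipschitzOnWith := fun t ht => (hK t ht).mono hball
      continuousOn := fun z _ => (hb.continuousOn z).mono fun t ht => ha.trans_le ht.1
      norm_le := fun t ht z _ => hb.norm_le (ha.trans_le ht.1) z
      mul_max_le := by simp [r, sub_nonneg.2 hac] }
  exact hPL.exists_eq_forall_mem_Icc_hasDerivWithinAt₀

lemma isIntegralCurveOn_of_tendsto [CompleteSpace E] (hb : IsDissipativeField b M) (ha : 0 < a)
    {ι : Type*} {l : Filter ι} [l.NeBot] {γ : ι → ℝ → E} {z : ℝ → E}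
    (hγ : ∀ᶠ i in l, IsIntegralCurveOn (γ i) b (Icc a c))
    (hz : ∀ t ∈ Icc a c, Tendsto (fun i => γ i t) l (𝓝 (z t))) :
    IsIntegralCurveOn z b (Icc a c) := by
  rcases lt_or_ge c a with hca | hac
  · simp [IsIntegralCurveOn, Icc_eq_empty_of_lt hca]
  obtain ⟨β, hβa, hβ⟩ := hb.exists_isIntegralCurveOn ha hac (z a)
  have hzβ : EqOn z β (Icc a c) := fun t ht => by
    refine tendsto_nhds_unique (hz t ht) (tendsto_iff_norm_sub_tendsto_zero.2 ?_)
    refine squeeze_zero' (Eventually.of_forall fun _ => norm_nonneg _)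
      (hγ.mono fun i hi => hb.norm_sub_le_of_isIntegralCurveOn ha hi hβ ht) ?_
    rw [hβa]
    exact tendsto_iff_norm_sub_tendsto_zero.1 (hz a (left_mem_Icc.2 hac))
  intro t ht
  rw [hzβ ht]
  exact (hβ t ht).congr hzβ (hzβ ht)

lemma dist_left_le_of_isIntegralCurveOn (hb : IsDissipativeField b M) (ha : 0 < a)
    (hα : IsIntegralCurveOn α b (Icc a c)) {t : ℝ} (ht : t ∈ Icc a c) :
    dist (α t) (α a) ≤ M * t := by
  refine ((hb.lipschitzOnWith_of_isIntegralCurveOn ha hα).dist_le_mul t ht a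
    ⟨le_rfl, ht.1.trans ht.2⟩).trans (mul_le_mul_of_nonneg_left ?_ M.2)
  rw [Real.dist_eq, abs_of_nonneg (sub_nonneg.2 ht.1)]
  exact sub_le_self _ ha.le

lemma dist_le_of_left_eq (hb : IsDissipativeField b M) {s d e : ℝ} (hs : 0 < s) (hsd : s ≤ d)
    (hα : IsIntegralCurveOn α b (Icc s e)) (hβ : IsIntegralCurveOn β b (Icc d e))
    (hαβ : α s = β d) {t : ℝ} (ht : t ∈ Icc d e) : dist (α t) (β t) ≤ M * d :=
  calc dist (α t) (β t) = ‖α t - β t‖ := dist_eq_norm _ _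
    _ ≤ ‖α d - β d‖ := hb.norm_sub_le_of_isIntegralCurveOn (hs.trans_le hsd)
      (hα.mono (Icc_subset_Icc_left hsd)) hβ ht
    _ = dist (α d) (α s) := by rw [hαβ, dist_eq_norm]
    _ ≤ M * d := hb.dist_left_le_of_isIntegralCurveOn hs hα ⟨hsd, ht.1.trans ht.2⟩

lemma exists_tendsto_of_left_eq [CompleteSpace E] (hb : IsDissipativeField b M) {γ : ℝ → ℝ → E}
    {y : E} (hγy : ∀ δ ∈ Ioc (0 : ℝ) 1, γ δ δ = y)
    (hγ : ∀ δ ∈ Ioc (0 : ℝ) 1, IsIntegralCurveOn (γ δ) b (Icc δ δ⁻¹)) {t : ℝ} (ht : 0 < t) :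
    ∃ x, Tendsto (fun δ => γ δ t) (𝓝[>] 0) (𝓝 x) := by
  have hg : Tendsto (fun d : ℝ => M * d) (𝓝[>] 0) (𝓝 0) := by
    simpa using ((continuous_const_mul (M : ℝ)).tendsto 0).mono_left nhdsWithin_le_nhds
  refine exists_tendsto_nhdsGT_of_dist_le hg ?_
  filter_upwards [Ioc_mem_nhdsGT one_pos, Ioc_mem_nhdsGT ht, Ioc_mem_nhdsGT (inv_pos.2 ht)]
    with d hd hdt hdt' s hs
  have hs' : s ∈ Ioc (0 : ℝ) 1 := ⟨hs.1, hs.2.trans hd.2⟩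
  have hinv : d⁻¹ ≤ s⁻¹ := inv_anti₀ hs.1 hs.2
  exact hb.dist_le_of_left_eq hs.1 hs.2 ((hγ s hs').mono (Icc_subset_Icc_right hinv)) (hγ d hd)
    ((hγy s hs').trans (hγy d hd).symm) ⟨hdt.2, (le_inv_comm₀ hd.1 ht).1 hdt'.2⟩

/-- Solutions started from `y` at small times `δ` do not separate, so they converge as `δ → 0⁺`. -/
theorem exists_solution [CompleteSpace E] (hb : IsDissipativeField b M) (y : E) :
    ∃ z : ℝ → E, z 0 = y ∧ ContinuousOn z (Ici 0) ∧ ∀ t, 0 < t → HasDerivAt z (b t (z t)) t := by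
  have hcurve : ∀ δ ∈ Ioc (0 : ℝ) 1, ∃ γ, γ δ = y ∧ IsIntegralCurveOn γ b (Icc δ δ⁻¹) :=
    fun δ hδ => hb.exists_isIntegralCurveOn hδ.1 (hδ.2.trans (one_le_inv₀ hδ.1 |>.2 hδ.2)) y
  choose! γ hγy hγ using hcurve
  have hlim : ∀ t : ℝ, 0 < t → ∃ x, Tendsto (fun δ => γ δ t) (𝓝[>] 0) (𝓝 x) :=
    fun t ht => hb.exists_tendsto_of_left_eq hγy hγ ht
  choose! Z hZ using hlim
  let z : ℝ → E := Function.update Z 0 y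
  have hz : ∀ t, 0 < t → Tendsto (fun δ => γ δ t) (𝓝[>] 0) (𝓝 (z t)) := fun t ht => by
    simpa [z, ht.ne'] using hZ t ht
  have hderiv : ∀ t, 0 < t → HasDerivAt z (b t (z t)) t := fun t ht => by
    have hcurve : ∀ᶠ δ in 𝓝[>] (0 : ℝ), IsIntegralCurveOn (γ δ) b (Icc (t / 2) (2 * t)) := by
      filter_upwards [Ioc_mem_nhdsGT one_pos, Ioc_mem_nhdsGT (half_pos ht),
        Ioc_mem_nhdsGT (inv_pos.2 (mul_pos two_pos ht))] with δ hδ hδt hδt'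
      exact (hγ δ hδ).mono (Icc_subset_Icc hδt.2 ((le_inv_comm₀ hδ.1 (by positivity)).1 hδt'.2))
    have hzt := hb.isIntegralCurveOn_of_tendsto (half_pos ht) hcurve
      fun s hs => hz s ((half_pos ht).trans_le hs.1)
    exact (hzt t ⟨by linarith, by linarith⟩).hasDerivAt (Icc_mem_nhds (by linarith) (by linarith))
  have hspeed : ∀ t, 0 < t → dist (z t) y ≤ M * t := fun t ht => by
    refine le_of_tendsto ((hz t ht).dist tendsto_const_nhds) ?_
    filter_upwards [Ioc_mem_nhdsGT one_pos, Ioc_mem_nhdsGT ht, Ioc_mem_nhdsGT (inv_pos.2 ht)]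
      with δ hδ hδt hδt'
    simpa only [hγy δ hδ] using hb.dist_left_le_of_isIntegralCurveOn hδ.1 (hγ δ hδ)
      ⟨hδt.2, (le_inv_comm₀ hδ.1 ht).1 hδt'.2⟩
  have hz0 : z 0 = y := Function.update_self ..
  refine ⟨z, hz0, fun t ht => ?_, hderiv⟩
  rcases (mem_Ici.1 ht).eq_or_lt with rfl | ht
  · rw [← continuousWithinAt_Ioi_iff_Ici, ContinuousWithinAt, hz0, tendsto_iff_dist_tendsto_zero]
    refine squeeze_zero' (Eventually.of_forall fun _ => dist_nonneg)
      (eventually_mem_nhdsWithin.mono hspeed) ?_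
    simpa using ((continuous_const_mul (M : ℝ)).tendsto 0).mono_left nhdsWithin_le_nhds
  · exact (hderiv t ht).continuousAt.continuousWithinAt

end IsDissipativeField

end DissipativeField

/-! ### The Cole–Hopf velocity of a potential with bounded supergradients -/

section ColeHopf

lemma mul_le_mul_sq_add_sq_div {b : ℝ} (hb : 0 < b) (c r : ℝ) :
    c * r ≤ b * r ^ 2 + c ^ 2 / (4 * b) := by
  have square : b * r ^ 2 + c ^ 2 / (4 * b) - c * r = (2 * b * r - c) ^ 2 / (4 * b) := by
    field_simp
    ring
  have : 0 ≤ (2 * b * r - c) ^ 2 / (4 * b) := by positivity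
  linarith

lemma abs_exp_sub_exp_le_mul {a b w : ℝ} (ha : Real.exp a ≤ w) (hb : Real.exp b ≤ w) :
    |Real.exp a - Real.exp b| ≤ w * |a - b| := by
  wlog hab : b ≤ a generalizing a b
  · rw [abs_sub_comm, abs_sub_comm a b]
    exact this hb ha (le_of_not_ge hab)
  rw [abs_of_nonneg (sub_nonneg.2 (Real.exp_le_exp.2 hab)), abs_of_nonneg (sub_nonneg.2 hab)]
  calc Real.exp a - Real.exp b = Real.exp a * (1 - Real.exp (b - a)) := by
        rw [mul_sub, ← Real.exp_add, mul_one, add_sub_cancel]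
    _ ≤ Real.exp a * (a - b) := by
        have := Real.add_one_le_exp (b - a)
        gcongr ?_ * ?_
        linarith
    _ ≤ w * (a - b) := mul_le_mul_of_nonneg_right ha (sub_nonneg.2 hab)

lemma norm_inv_smul_sub_le {F : Type*} [NormedAddCommGroup F] [NormedSpace ℝ F] {m m' M : ℝ}
    {p p' : F} (hm : 0 < m) (hm' : m' ≠ 0) (hp' : ‖m'⁻¹ • p'‖ ≤ M) :
    ‖m⁻¹ • p - m'⁻¹ • p'‖ ≤ m⁻¹ * (‖p - p'‖ + |m - m'| * M) := by
  have split : m⁻¹ • p - m'⁻¹ • p' = m⁻¹ • ((p - p') - (m - m') • m'⁻¹ • p') := by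
    match_scalars <;> field_simp
    ring
  rw [split, norm_smul, Real.norm_of_nonneg (inv_nonneg.2 hm.le)]
  gcongr
  refine (norm_sub_le _ _).trans ?_
  rw [norm_smul, Real.norm_eq_abs]
  gcongr

lemma exp_mean_mul_integral_le {α : Type*} [MeasurableSpace α] {μ : Measure α} {w s f : α → ℝ}
    {b : ℝ} (hw₀ : ∀ y, 0 ≤ w y) (hw : Integrable w μ) (hws : Integrable (fun y => w y * s y) μ)
    (hf : Integrable f μ) (hle : ∀ y, w y * Real.exp (s y) ≤ f y)
    (hb : ∫ y, w y * s y ∂μ = b * ∫ y, w y ∂μ) :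
    Real.exp b * ∫ y, w y ∂μ ≤ ∫ y, f y ∂μ := by
  have tangent : ∀ y, Real.exp b * ((1 - b) * w y + w y * s y) ≤ f y := fun y =>
    calc Real.exp b * ((1 - b) * w y + w y * s y)
        = w y * (Real.exp b * (s y - b + 1)) := by ring
      _ ≤ w y * (Real.exp b * Real.exp (s y - b)) := by
          have := hw₀ y
          gcongr
          exact Real.add_one_le_exp _
      _ = w y * Real.exp (s y) := by rw [← Real.exp_add, add_sub_cancel]
      _ ≤ f y := hle y
  calc Real.exp b * ∫ y, w y ∂μ = ∫ y, Real.exp b * ((1 - b) * w y + w y * s y) ∂μ := by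
        rw [integral_const_mul, integral_add (hw.const_mul _) hws, integral_const_mul, hb]
        ring
    _ ≤ ∫ y, f y ∂μ := integral_mono (((hw.const_mul _).add hws).const_mul _) hf tangent

variable {E : Type*} [NormedAddCommGroup E] {φ : E → ℝ} {ε t : ℝ}

/-- The unnormalized density of the initial position, given the position `x` at time `t`. -/
noncomputable def weight (φ : E → ℝ) (ε t : ℝ) (x y : E) : ℝ :=
  Real.exp (-(‖x - y‖ ^ 2) / (2 * ε * t) - φ y / ε)

lemma weight_pos (φ : E → ℝ) (ε t : ℝ) (x y : E) : 0 < weight φ ε t x y :=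
  Real.exp_pos _

lemma weight_le_exp_norm_mul_weight (φ : E → ℝ) (ε t : ℝ) (x y : E) :
    weight φ ε t x y ≤ Real.exp ‖y‖ * weight φ ε t x y :=
  le_mul_of_one_le_left (weight_pos ..).le (Real.one_le_exp (norm_nonneg y))

lemma continuousOn_weight (hε : 0 < ε) (φ : E → ℝ) (x y : E) :
    ContinuousOn (fun t => weight φ ε t x y) (Ioi 0) := by
  unfold weight
  refine Real.continuous_exp.comp_continuousOn ((continuousOn_const.div (by fun_prop)
    fun t ht => ?_).sub continuousOn_const)
  have : 0 < t := ht
  positivity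

lemma abs_exponent_sub_le {δ R : ℝ} (hε : 0 < ε) (hδ : 0 < δ) (hδt : δ ≤ t) {x z : E}
    (hx : ‖x‖ ≤ R) (hz : ‖z‖ ≤ R) (y : E) :
    |-(‖x - y‖ ^ 2) / (2 * ε * t) - φ y / ε - (-(‖z - y‖ ^ 2) / (2 * ε * t) - φ y / ε)| ≤
      Real.exp ‖y‖ * ((R + 1) / (ε * δ) * ‖x - z‖) := by
  have ht : 0 < t := hδ.trans_le hδt
  have difference : |‖z - y‖ - ‖x - y‖| ≤ ‖x - z‖ := by
    simpa [norm_sub_rev z x] using abs_norm_sub_norm_le (z - y) (x - y)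
  have sum : ‖z - y‖ + ‖x - y‖ ≤ 2 * (R + 1) * Real.exp ‖y‖ := by
    nlinarith [norm_sub_le z y, norm_sub_le x y, Real.add_one_le_exp ‖y‖, norm_nonneg y,
      norm_nonneg x]
  calc |-(‖x - y‖ ^ 2) / (2 * ε * t) - φ y / ε - (-(‖z - y‖ ^ 2) / (2 * ε * t) - φ y / ε)|
      = |(‖z - y‖ - ‖x - y‖) * (‖z - y‖ + ‖x - y‖) / (2 * ε * t)| := by
        congr 1
        ring
    _ = |‖z - y‖ - ‖x - y‖| * (‖z - y‖ + ‖x - y‖) / (2 * ε * t) := by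
        rw [abs_div, abs_mul, abs_of_nonneg (by positivity : 0 ≤ ‖z - y‖ + ‖x - y‖),
          abs_of_pos (by positivity : 0 < 2 * ε * t)]
    _ ≤ ‖x - z‖ * (2 * (R + 1) * Real.exp ‖y‖) / (2 * ε * δ) := by
        have : 0 ≤ R := (norm_nonneg x).trans hx
        gcongr
    _ = Real.exp ‖y‖ * ((R + 1) / (ε * δ) * ‖x - z‖) := by field_simp

lemma abs_weight_sub_weight_le {δ R G : ℝ} (hε : 0 < ε) (hδ : 0 < δ) (hδt : δ ≤ t) {x y z : E}
    (hx : ‖x‖ ≤ R) (hz : ‖z‖ ≤ R) (hGx : Real.exp ‖y‖ * weight φ ε t x y ≤ G)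
    (hGz : Real.exp ‖y‖ * weight φ ε t z y ≤ G) :
    |weight φ ε t x y - weight φ ε t z y| ≤ G * ((R + 1) / (ε * δ) * ‖x - z‖) := by
  have hG : 0 ≤ G := le_trans (mul_pos (Real.exp_pos _) (weight_pos ..)).le hGx
  have hexp := Real.exp_pos ‖y‖
  calc |weight φ ε t x y - weight φ ε t z y|
      ≤ G / Real.exp ‖y‖ * _ :=
        abs_exp_sub_exp_le_mul ((le_div_iff₀' hexp).2 hGx) ((le_div_iff₀' hexp).2 hGz)
    _ ≤ G / Real.exp ‖y‖ * (Real.exp ‖y‖ * ((R + 1) / (ε * δ) * ‖x - z‖)) := by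
        gcongr
        exact abs_exponent_sub_le hε hδ hδt hx hz y
    _ = G * ((R + 1) / (ε * δ) * ‖x - z‖) := by rw [← mul_assoc, div_mul_cancel₀ _ hexp.ne']

variable [InnerProductSpace ℝ E] {s : E → E} {M : ℝ≥0}

/-- A measurable selection `s` of supergradients of `φ`, bounded by `M`. -/
structure IsBoundedSupergradient [MeasurableSpace E] (φ : E → ℝ) (s : E → E) (M : ℝ≥0) :
    Prop where
  measurable : Measurable s
  norm_le : ∀ y, ‖s y‖ ≤ M
  mem_superdifferential : ∀ y, s y ∈ superdifferential φ y

lemma isBoundedSupergradient_affine [MeasurableSpace E] (a : ℝ) (q : E) :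
    IsBoundedSupergradient (fun y => a + inner ℝ q y) (fun _ => q) ‖q‖₊ where
  measurable := measurable_const
  norm_le _ := le_rfl
  mem_superdifferential y z := by simp [inner_sub_right]

lemma weight_affine (hε : 0 < ε) (ht : 0 < t) (a : ℝ) (q x y : E) :
    weight (fun y => a + inner ℝ q y) ε t x y =
      Real.exp (-(a + inner ℝ q x - t / 2 * ‖q‖ ^ 2) / ε) *
        Real.exp (-(1 / (2 * ε * t)) * ‖y - (x - t • q)‖ ^ 2) := by
  have square : ‖y - (x - t • q)‖ ^ 2 =
      ‖x - y‖ ^ 2 + 2 * t * (inner ℝ q y - inner ℝ q x) + t ^ 2 * ‖q‖ ^ 2 := by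
    rw [← sub_add, norm_add_sq_real, norm_sub_rev, inner_smul_right, real_inner_comm,
      inner_sub_right, norm_smul, Real.norm_eq_abs, mul_pow, sq_abs]
    ring
  rw [weight, ← Real.exp_add, square]
  congr 1
  field_simp
  ring

lemma weight_mul_exp_le_weight_add {q x y h : E} (hε : 0 < ε) (hq : q ∈ superdifferential φ y) :
    weight φ ε t x y * Real.exp (-inner ℝ q h / ε) ≤ weight φ ε t (x + h) (y + h) := by
  have hφ : φ (y + h) / ε ≤ φ y / ε + inner ℝ q h / ε := by
    rw [← add_div]
    gcongr
    simpa using hq (y + h)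
  rw [weight, weight, ← Real.exp_add, add_sub_add_right_eq_sub, Real.exp_le_exp, neg_div ε]
  linarith

variable [MeasurableSpace E]

lemma IsBoundedSupergradient.lipschitzWith (hs : IsBoundedSupergradient φ s M) :
    LipschitzWith M φ := by
  refine LipschitzWith.of_le_add_mul M fun x y => ?_
  calc φ x ≤ φ y + inner ℝ (s y) (x - y) := hs.mem_superdifferential y x
    _ ≤ φ y + M * dist x y := by
        rw [dist_eq_norm]
        gcongr
        exact (real_inner_le_norm _ _).trans
          (mul_le_mul_of_nonneg_right (hs.norm_le y) (norm_nonneg _))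

lemma IsBoundedSupergradient.neg_le (hs : IsBoundedSupergradient φ s M) (y : E) :
    -φ y ≤ -φ 0 + M * ‖y‖ := by
  have := hs.lipschitzWith.le_add_mul 0 y
  rw [dist_zero_left] at this
  linarith

lemma IsBoundedSupergradient.exp_norm_mul_weight_le (hs : IsBoundedSupergradient φ s M)
    {N R : ℝ} (hε : 0 < ε) (ht : t ∈ Ioc 0 N) {x : E} (hx : ‖x‖ ≤ R) (y : E) :
    Real.exp ‖y‖ * weight φ ε t x y ≤
      Real.exp (-φ 0 / ε + R ^ 2 / (2 * ε * N) + (1 + M / ε) ^ 2 * (2 * ε * N)) *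
        Real.exp (-(1 / (8 * ε * N)) * ‖y‖ ^ 2) := by
  have hN : 0 < N := ht.1.trans_le ht.2
  rw [weight, ← Real.exp_add, ← Real.exp_add, Real.exp_le_exp]
  have hxy : ‖y‖ ^ 2 / 2 - R ^ 2 ≤ ‖x - y‖ ^ 2 := by
    have hyx : ‖y‖ ≤ R + ‖x - y‖ := by linarith [norm_sub_norm_le y x, norm_sub_rev x y]
    nlinarith [sq_nonneg (‖x - y‖ - R), pow_le_pow_left₀ (norm_nonneg y) hyx 2]
  have kinetic : (‖y‖ ^ 2 / 2 - R ^ 2) / (2 * ε * N) ≤ ‖x - y‖ ^ 2 / (2 * ε * t) :=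
    calc (‖y‖ ^ 2 / 2 - R ^ 2) / (2 * ε * N) ≤ ‖x - y‖ ^ 2 / (2 * ε * N) := by gcongr
      _ ≤ ‖x - y‖ ^ 2 / (2 * ε * t) := by
          have := ht.1
          gcongr
          exact ht.2
  have potential : -φ y / ε ≤ -φ 0 / ε + M / ε * ‖y‖ := by
    rw [div_mul_eq_mul_div, ← add_div]
    gcongr
    exact hs.neg_le y
  have linear := mul_le_mul_sq_add_sq_div (by positivity : 0 < 1 / (8 * ε * N)) (1 + M / ε) ‖y‖
  have constants : (1 + M / ε) ^ 2 / (4 * (1 / (8 * ε * N))) = (1 + M / ε) ^ 2 * (2 * ε * N) := by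
    field_simp
    ring
  have split : (‖y‖ ^ 2 / 2 - R ^ 2) / (2 * ε * N) =
      2 * (1 / (8 * ε * N) * ‖y‖ ^ 2) - R ^ 2 / (2 * ε * N) := by
    field_simp
    ring
  rw [neg_div, sub_eq_add_neg, ← neg_div ε]
  linarith

lemma IsBoundedSupergradient.norm_weight_smul_le (hs : IsBoundedSupergradient φ s M)
    (ε t : ℝ) (x y : E) : ‖weight φ ε t x y • s y‖ ≤ weight φ ε t x y * M := by
  rw [norm_smul, Real.norm_of_nonneg (weight_pos ..).le]
  exact mul_le_mul_of_nonneg_left (hs.norm_le y) (weight_pos ..).le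

variable [BorelSpace E]

lemma IsBoundedSupergradient.measurable_weight (hs : IsBoundedSupergradient φ s M) (ε t : ℝ)
    (x : E) : Measurable (weight φ ε t x) := by
  have := hs.lipschitzWith.continuous
  unfold weight
  exact Continuous.measurable (by fun_prop)

variable [FiniteDimensional ℝ E]

lemma integrable_exp_neg_mul_norm_sq {b : ℝ} (hb : 0 < b) :
    Integrable fun y : E => Real.exp (-b * ‖y‖ ^ 2) := by
  refine Integrable.of_integral_ne_zero ?_
  rw [GaussianFourier.integral_rexp_neg_mul_sq_norm hb]
  positivity

lemma IsBoundedSupergradient.exists_integrable_bound (hs : IsBoundedSupergradient φ s M)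
    {N : ℝ} (hε : 0 < ε) (hN : 0 < N) (R : ℝ) :
    ∃ g : E → ℝ, Integrable g ∧ (∀ y, 0 ≤ g y) ∧ ∀ t ∈ Ioc 0 N, ∀ x : E, ‖x‖ ≤ R → ∀ y,
      Real.exp ‖y‖ * weight φ ε t x y ≤ g y :=
  ⟨_, (integrable_exp_neg_mul_norm_sq (by positivity)).const_mul _, fun _ => by positivity,
    fun _ ht _ hx => hs.exp_norm_mul_weight_le hε ht hx⟩

lemma IsBoundedSupergradient.integrable_weight (hs : IsBoundedSupergradient φ s M)
    (hε : 0 < ε) (ht : 0 < t) (x : E) : Integrable (weight φ ε t x) := by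
  obtain ⟨g, hg, -, hle⟩ := hs.exists_integrable_bound hε ht ‖x‖
  refine hg.mono' (hs.measurable_weight ε t x).aestronglyMeasurable (ae_of_all _ fun y => ?_)
  rw [Real.norm_of_nonneg (weight_pos ..).le]
  exact (weight_le_exp_norm_mul_weight φ ε t x y).trans (hle t ⟨ht, le_rfl⟩ x le_rfl y)

lemma IsBoundedSupergradient.integrable_weight_smul (hs : IsBoundedSupergradient φ s M)
    (hε : 0 < ε) (ht : 0 < t) (x : E) : Integrable fun y => weight φ ε t x y • s y :=
  ((hs.integrable_weight hε ht x).mul_const M).mono'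
    ((hs.measurable_weight ε t x).smul hs.measurable).aestronglyMeasurable
    (ae_of_all _ (hs.norm_weight_smul_le ε t x))

/-- The total mass of `weight`. -/
noncomputable def mass (φ : E → ℝ) (ε t : ℝ) (x : E) : ℝ :=
  ∫ y, weight φ ε t x y

/-- The integral of the initial velocity `s` against `weight`. -/
noncomputable def momentum (φ : E → ℝ) (s : E → E) (ε t : ℝ) (x : E) : E :=
  ∫ y, weight φ ε t x y • s y

/-- The Cole–Hopf velocity: the mean of the initial velocity `s`. -/
noncomputable def drift (φ : E → ℝ) (s : E → E) (ε t : ℝ) (x : E) : E :=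
  (mass φ ε t x)⁻¹ • momentum φ s ε t x

lemma mass_affine (hε : 0 < ε) (ht : 0 < t) (a : ℝ) (q x : E) :
    mass (fun y => a + inner ℝ q y) ε t x =
      (2 * Real.pi * ε * t) ^ (Module.finrank ℝ E / 2 : ℝ) *
        Real.exp (-(a + inner ℝ q x - t / 2 * ‖q‖ ^ 2) / ε) := by
  simp only [mass, weight_affine hε ht, integral_const_mul]
  rw [integral_sub_right_eq_self (fun y : E => Real.exp (-(1 / (2 * ε * t)) * ‖y‖ ^ 2)),
    GaussianFourier.integral_rexp_neg_mul_sq_norm (by positivity), mul_comm]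
  congr 2
  field_simp

lemma mass_anti {ψ : E → ℝ} {r : E → E} {N : ℝ≥0} (hs : IsBoundedSupergradient φ s M)
    (hr : IsBoundedSupergradient ψ r N) (hle : ∀ y, φ y ≤ ψ y) (hε : 0 < ε) (ht : 0 < t) (x : E) :
    mass ψ ε t x ≤ mass φ ε t x := by
  refine integral_mono (hr.integrable_weight hε ht x) (hs.integrable_weight hε ht x) fun y => ?_
  unfold weight
  gcongr
  exact hle y

namespace IsBoundedSupergradient

variable (hs : IsBoundedSupergradient φ s M)
include hs

lemma mass_lower_bound {δ R : ℝ} (hε : 0 < ε) (hδ : 0 < δ) (hδt : δ ≤ t) {x : E}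
    (hx : ‖x‖ ≤ R) :
    (2 * Real.pi * ε * δ) ^ (Module.finrank ℝ E / 2 : ℝ) * Real.exp (-(φ 0 + M * R) / ε) ≤
      mass φ ε t x := by
  have ht : 0 < t := hδ.trans_le hδt
  have tangent : ∀ y, φ y ≤ φ 0 + inner ℝ (s 0) y := fun y => by
    simpa using hs.mem_superdifferential 0 y
  refine le_trans ?_ (mass_anti hs (isBoundedSupergradient_affine (φ 0) (s 0)) tangent hε ht x)
  rw [mass_affine hε ht]
  have inner_le : inner ℝ (s 0) x ≤ M * R :=
    (real_inner_le_norm _ _).trans (mul_le_mul (hs.norm_le 0) hx (norm_nonneg _) M.2)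
  have : φ 0 + inner ℝ (s 0) x - t / 2 * ‖s 0‖ ^ 2 ≤ φ 0 + M * R := by
    linarith [show 0 ≤ t / 2 * ‖s 0‖ ^ 2 by positivity]
  gcongr

lemma mass_pos (hε : 0 < ε) (ht : 0 < t) (x : E) : 0 < mass φ ε t x :=
  lt_of_lt_of_le (by positivity) (hs.mass_lower_bound hε ht le_rfl (le_refl ‖x‖))

lemma integral_weight_mul_inner (hε : 0 < ε) (ht : 0 < t) (x h : E) :
    ∫ y, weight φ ε t x y * inner ℝ (s y) h = inner ℝ (drift φ s ε t x) h * mass φ ε t x := by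
  have hmomentum := integral_inner (𝕜 := ℝ) (hs.integrable_weight_smul hε ht x) h
  simp only [real_inner_comm _ h, real_inner_smul_left] at hmomentum
  rw [hmomentum, drift, real_inner_smul_left, momentum, inv_mul_eq_div,
    div_mul_cancel₀ _ (hs.mass_pos hε ht x).ne']

lemma exp_drift_mul_mass_le (hε : 0 < ε) (ht : 0 < t) (x h : E) :
    Real.exp (-inner ℝ (drift φ s ε t x) h / ε) * mass φ ε t x ≤ mass φ ε t (x + h) := by
  have translate : mass φ ε t (x + h) = ∫ y, weight φ ε t (x + h) (y + h) :=
    (integral_add_right_eq_self (weight φ ε t (x + h)) h).symm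
  have hint : Integrable fun y => weight φ ε t x y * inner ℝ (s y) h := by
    simpa only [real_inner_smul_left] using
      (hs.integrable_weight_smul hε ht x).inner_const (𝕜 := ℝ) h
  have scale : ∀ y, weight φ ε t x y * (-inner ℝ (s y) h / ε) =
      -ε⁻¹ * (weight φ ε t x y * inner ℝ (s y) h) := fun y => by ring
  rw [translate]
  refine exp_mean_mul_integral_le (s := fun y => -inner ℝ (s y) h / ε)
    (fun y => (weight_pos φ ε t x y).le) (hs.integrable_weight hε ht x) ?_
    ((hs.integrable_weight hε ht (x + h)).comp_add_right h)
    (fun y => weight_mul_exp_le_weight_add hε (hs.mem_superdifferential y)) ?_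
  · simpa only [scale] using hint.const_mul _
  · simp only [scale]
    rw [integral_const_mul, hs.integral_weight_mul_inner hε ht, mass]
    ring

theorem drift_mem_superdifferential (hε : 0 < ε) (ht : 0 < t) {c : ℝ} (hc : 0 < c) (x : E) :
    drift φ s ε t x ∈ superdifferential (fun x => -ε * Real.log (c * mass φ ε t x)) x := by
  intro z
  have hx := hs.mass_pos hε ht x
  have hz := hs.mass_pos hε ht z
  have hlog := Real.log_le_log (by positivity) (hs.exp_drift_mul_mass_le hε ht x (z - x))
  rw [add_sub_cancel, Real.log_mul (Real.exp_pos _).ne' hx.ne', Real.log_exp, neg_div,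
    neg_add_eq_sub, sub_le_iff_le_add, ← sub_le_iff_le_add', le_div_iff₀ hε] at hlog
  simp only [Real.log_mul hc.ne' hx.ne', Real.log_mul hc.ne' hz.ne']
  linarith

lemma norm_drift_le (hε : 0 < ε) (ht : 0 < t) (x : E) : ‖drift φ s ε t x‖ ≤ M := by
  have hm := hs.mass_pos hε ht x
  rw [drift, norm_smul, norm_inv, Real.norm_of_nonneg hm.le, inv_mul_le_iff₀ hm, mass,
    ← integral_mul_const]
  exact norm_integral_le_of_norm_le ((hs.integrable_weight hε ht x).mul_const _)
    (ae_of_all _ (hs.norm_weight_smul_le ε t x))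

lemma abs_mass_sub_le (hε : 0 < ε) (ht : 0 < t) {x z : E} {g : E → ℝ} (hg : Integrable g)
    (hle : ∀ y, |weight φ ε t x y - weight φ ε t z y| ≤ g y) :
    |mass φ ε t x - mass φ ε t z| ≤ ∫ y, g y := by
  rw [mass, mass, ← integral_sub (hs.integrable_weight hε ht x) (hs.integrable_weight hε ht z)]
  exact norm_integral_le_of_norm_le (f := fun y => weight φ ε t x y - weight φ ε t z y) hg
    (ae_of_all _ hle)

lemma norm_momentum_sub_le (hε : 0 < ε) (ht : 0 < t) {x z : E} {g : E → ℝ} (hg : Integrable g)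
    (hle : ∀ y, |weight φ ε t x y - weight φ ε t z y| ≤ g y) :
    ‖momentum φ s ε t x - momentum φ s ε t z‖ ≤ (∫ y, g y) * M := by
  rw [momentum, momentum, ← integral_sub (hs.integrable_weight_smul hε ht x)
    (hs.integrable_weight_smul hε ht z), ← integral_mul_const]
  refine norm_integral_le_of_norm_le (hg.mul_const _) (ae_of_all _ fun y => ?_)
  rw [← sub_smul, norm_smul]
  exact mul_le_mul (hle y) (hs.norm_le y) (norm_nonneg _) ((abs_nonneg _).trans (hle y))

lemma exists_lipschitzOnWith_drift {a : ℝ} (hε : 0 < ε) (ha : 0 < a) (c R : ℝ) :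
    ∃ K : ℝ≥0, ∀ t ∈ Icc a c, LipschitzOnWith K (drift φ s ε t) (Metric.closedBall 0 R) := by
  obtain ⟨g, hg, hg₀, hle⟩ := hs.exists_integrable_bound hε (lt_max_of_lt_left ha : 0 < max a c) R
  set A := (∫ y, g y) * ((R + 1) / (ε * a)) with hA
  set m := (2 * Real.pi * ε * a) ^ (Module.finrank ℝ E / 2 : ℝ) * Real.exp (-(φ 0 + M * R) / ε)
  refine ⟨(2 * A * M / m).toNNReal, fun t ht => LipschitzOnWith.of_dist_le_mul
    fun x hx z hz => ?_⟩
  rw [mem_closedBall_zero_iff] at hx hz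
  have ht₀ : 0 < t := ha.trans_le ht.1
  have htN : t ∈ Ioc 0 (max a c) := ⟨ht₀, ht.2.trans (le_max_right _ _)⟩
  have hR : 0 ≤ R := (norm_nonneg x).trans hx
  have hA₀ : 0 ≤ A := mul_nonneg (integral_nonneg hg₀) (by positivity)
  have hint : Integrable fun y => g y * ((R + 1) / (ε * a) * ‖x - z‖) := hg.mul_const _
  have hweight : ∀ y, |weight φ ε t x y - weight φ ε t z y| ≤
      g y * ((R + 1) / (ε * a) * ‖x - z‖) := fun y =>
    abs_weight_sub_weight_le hε ha ht.1 hx hz (hle t htN x hx y) (hle t htN z hz y)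
  have hintegral : ∫ y, g y * ((R + 1) / (ε * a) * ‖x - z‖) = A * ‖x - z‖ := by
    rw [integral_mul_const, hA, mul_assoc]
  have hmass := hs.abs_mass_sub_le hε ht₀ hint hweight
  have hmomentum := hs.norm_momentum_sub_le hε ht₀ hint hweight
  rw [hintegral] at hmass hmomentum
  have hmx : m ≤ mass φ ε t x := hs.mass_lower_bound hε ha ht.1 hx
  rw [dist_eq_norm, dist_eq_norm, Real.coe_toNNReal _ (by positivity)]
  calc ‖drift φ s ε t x - drift φ s ε t z‖
      ≤ (mass φ ε t x)⁻¹ * (‖momentum φ s ε t x - momentum φ s ε t z‖ +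
          |mass φ ε t x - mass φ ε t z| * M) :=
        norm_inv_smul_sub_le (hs.mass_pos hε ht₀ x) (hs.mass_pos hε ht₀ z).ne'
          (hs.norm_drift_le hε ht₀ z)
    _ ≤ m⁻¹ * (A * ‖x - z‖ * M + A * ‖x - z‖ * M) := by gcongr
    _ = 2 * A * M / m * ‖x - z‖ := by ring

lemma continuousOn_drift (hε : 0 < ε) (x : E) :
    ContinuousOn (fun t => drift φ s ε t x) (Ioi 0) := by
  intro t₀ (ht₀ : 0 < t₀)
  have hpos : 0 < 2 * t₀ := by positivity
  obtain ⟨g, hg, -, hle⟩ := hs.exists_integrable_bound hε hpos ‖x‖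
  have hweight : ∀ t ∈ Ioo 0 (2 * t₀), ∀ y, weight φ ε t x y ≤ g y := fun t ht y =>
    (weight_le_exp_norm_mul_weight φ ε t x y).trans (hle t ⟨ht.1, ht.2.le⟩ x le_rfl y)
  have hcont : ∀ y, ContinuousOn (fun t => weight φ ε t x y) (Ioo 0 (2 * t₀)) := fun y =>
    (continuousOn_weight hε φ x y).mono fun t ht => ht.1
  have hmass : ContinuousOn (fun t => mass φ ε t x) (Ioo 0 (2 * t₀)) := by
    refine continuousOn_of_dominated
      (fun t _ => (hs.measurable_weight ε t x).aestronglyMeasurable)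
      (fun t ht => ae_of_all _ fun y => ?_) hg (ae_of_all _ hcont)
    rw [Real.norm_of_nonneg (weight_pos ..).le]
    exact hweight t ht y
  have hmomentum : ContinuousOn (fun t => momentum φ s ε t x) (Ioo 0 (2 * t₀)) :=
    continuousOn_of_dominated
      (fun t _ => ((hs.measurable_weight ε t x).smul hs.measurable).aestronglyMeasurable)
      (fun t ht => ae_of_all _ fun y => (hs.norm_weight_smul_le ε t x y).trans
        (mul_le_mul_of_nonneg_right (hweight t ht y) M.2))
      (hg.mul_const _) (ae_of_all _ fun y => (hcont y).smul continuousOn_const)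
  have hdrift : ContinuousOn (fun t => drift φ s ε t x) (Ioo 0 (2 * t₀)) :=
    (hmass.inv₀ fun t ht => (hs.mass_pos hε ht.1 x).ne').smul hmomentum
  exact (hdrift.continuousAt (Ioo_mem_nhds ht₀ (by linarith))).continuousWithinAt

theorem isDissipativeField_drift (hε : 0 < ε) : IsDissipativeField (drift φ s ε) M where
  norm_le _ ht := hs.norm_drift_le hε ht
  inner_sub_nonpos _ ht x z := inner_sub_nonpos_of_mem_superdifferential
    (hs.drift_mem_superdifferential hε ht one_pos x)
    (hs.drift_mem_superdifferential hε ht one_pos z)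
  continuousOn := hs.continuousOn_drift hε
  lipschitzOnWith _ ha := hs.exists_lipschitzOnWith_drift hε ha

theorem hasGradientAt_neg_mul_log_mass (hε : 0 < ε) (ht : 0 < t) {c : ℝ} (hc : 0 < c) (x : E) :
    HasGradientAt (fun x => -ε * Real.log (c * mass φ ε t x)) (drift φ s ε t x) x := by
  obtain ⟨K, hK⟩ := hs.exists_lipschitzOnWith_drift hε ht t (‖x‖ + 1)
  refine hasGradientAt_of_mem_superdifferential (hs.drift_mem_superdifferential hε ht hc)
    ((hK t ⟨le_rfl, le_rfl⟩).continuousOn.continuousAt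
      (Metric.closedBall_mem_nhds_of_mem ?_))
  simp

end IsBoundedSupergradient

end ColeHopf

/-! ### The initial potential -/

section InitialPotential

lemma phi_le (v : Fin 3 → Plane) (y : Plane) (i : Fin 3) : phi v y ≤ inner ℝ (v i) y :=
  ciInf_le (finite_range _).bddBelow i

lemma exists_phi_eq (v : Fin 3 → Plane) (y : Plane) : ∃ i, phi v y = inner ℝ (v i) y := by
  obtain ⟨i, hi⟩ := exists_eq_ciInf_of_finite (f := fun i : Fin 3 => inner ℝ (v i) y)
  exact ⟨i, hi.symm⟩

lemma phi_zero (v : Fin 3 → Plane) : phi v 0 = 0 := by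
  simp only [phi, inner_zero_right, ciInf_const]

lemma phi_smul (v : Fin 3 → Plane) {r : ℝ} (hr : 0 ≤ r) (y : Plane) :
    phi v (r • y) = r * phi v y := by
  simp only [phi, inner_smul_right, Real.mul_iInf_of_nonneg hr]

lemma phi_le_inner_of_mem_convexHull {v : Fin 3 → Plane} {q : Plane}
    (hq : q ∈ convexHull ℝ (range v)) (y : Plane) : phi v y ≤ inner ℝ q y :=
  le_inner_of_mem_convexHull hq (forall_mem_range.2 (phi_le v y))

/-- The face of the triangle on which the linear form `⟪·, y⟫` attains its minimum `phi v y`. -/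
def face (v : Fin 3 → Plane) (y : Plane) : Set Plane :=
  {q ∈ convexHull ℝ (range v) | inner ℝ q y = phi v y}

lemma mem_face_of_inner_eq_phi {v : Fin 3 → Plane} {i : Fin 3} {y : Plane}
    (hi : inner ℝ (v i) y = phi v y) : v i ∈ face v y :=
  ⟨subset_convexHull ℝ _ (mem_range_self i), hi⟩

lemma face_subset_superdifferential (v : Fin 3 → Plane) (y : Plane) :
    face v y ⊆ superdifferential (phi v) y := fun q hq z => by
  rw [inner_sub_right, hq.2, add_sub_cancel]
  exact phi_le_inner_of_mem_convexHull hq.1 z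

lemma exists_measurable_selection_face (v : Fin 3 → Plane) :
    ∃ s : Plane → Plane, Measurable s ∧ ∀ y, ∃ i, s y = v i ∧ v i ∈ face v y := by
  have hmeas : ∀ i, MeasurableSet {y | inner ℝ (v i) y = phi v y} := fun i =>
    measurableSet_eq_fun (by fun_prop) (.iInf fun j => by fun_prop)
  classical
  refine ⟨fun y => if inner ℝ (v 0) y = phi v y then v 0 else
    if inner ℝ (v 1) y = phi v y then v 1 else v 2,
    .ite (hmeas 0) measurable_const (.ite (hmeas 1) measurable_const measurable_const),
    fun y => ?_⟩
  dsimp only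
  split_ifs with h₀ h₁
  · exact ⟨0, rfl, mem_face_of_inner_eq_phi h₀⟩
  · exact ⟨1, rfl, mem_face_of_inner_eq_phi h₁⟩
  · obtain ⟨i, hi⟩ := exists_phi_eq v y
    fin_cases i
    · exact absurd hi.symm h₀
    · exact absurd hi.symm h₁
    · exact ⟨2, rfl, mem_face_of_inner_eq_phi hi.symm⟩

lemma exists_isBoundedSupergradient_phi (v : Fin 3 → Plane) :
    ∃ s M, IsBoundedSupergradient (phi v) s M := by
  obtain ⟨s, hs, hface⟩ := exists_measurable_selection_face v
  refine ⟨s, Finset.univ.sup fun i => ‖v i‖₊, hs, fun y => ?_, fun y => ?_⟩ <;>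
    obtain ⟨i, hi, hmem⟩ := hface y <;> rw [hi]
  · exact_mod_cast Finset.le_sup (f := fun i => ‖v i‖₊) (Finset.mem_univ i)
  · exact face_subset_superdifferential v y hmem

/-- The lower envelope of the plane waves `⟪v i, x⟫ - t / 2 * ‖v i‖ ^ 2`, each of which solves
`∂_t u + |∇u|² / 2 = 0`. It extends `u` to `t = 0`. -/
noncomputable def planeWaveMin (v : Fin 3 → Plane) (t : ℝ) (x : Plane) : ℝ :=
  ⨅ i : Fin 3, (inner ℝ (v i) x - t / 2 * ‖v i‖ ^ 2)

lemma planeWaveMin_le (v : Fin 3 → Plane) (t : ℝ) (x : Plane) (i : Fin 3) :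
    planeWaveMin v t x ≤ inner ℝ (v i) x - t / 2 * ‖v i‖ ^ 2 :=
  ciInf_le (finite_range _).bddBelow i

lemma norm_sub_sq_div_two_add_mul_inner (p x y : Plane) (t : ℝ) :
    ‖x - y‖ ^ 2 / 2 + t * inner ℝ p y =
      t * (inner ℝ p x - t / 2 * ‖p‖ ^ 2) + ‖x - y - t • p‖ ^ 2 / 2 := by
  rw [norm_sub_sq_real (x - y), inner_smul_right, norm_smul, inner_sub_left, real_inner_comm p x,
    real_inner_comm p y, Real.norm_eq_abs, mul_pow, sq_abs]
  ring

lemma mul_planeWaveMin_le (v : Fin 3 → Plane) {t : ℝ} (ht : 0 ≤ t) (x y : Plane) :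
    t * planeWaveMin v t x ≤ ‖x - y‖ ^ 2 / 2 + t * phi v y := by
  obtain ⟨i, hi⟩ := exists_phi_eq v y
  rw [hi, norm_sub_sq_div_two_add_mul_inner]
  have := mul_le_mul_of_nonneg_left (planeWaveMin_le v t x i) ht
  linarith [sq_nonneg ‖x - y - t • v i‖]

lemma exists_mul_planeWaveMin_eq (v : Fin 3 → Plane) {t : ℝ} (ht : 0 ≤ t) (x : Plane) :
    ∃ y, ‖x - y‖ ^ 2 / 2 + t * phi v y = t * planeWaveMin v t x := by
  obtain ⟨i, hi⟩ := exists_eq_ciInf_of_finite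
    (f := fun i : Fin 3 => inner ℝ (v i) x - t / 2 * ‖v i‖ ^ 2)
  refine ⟨x - t • v i, le_antisymm ?_ (mul_planeWaveMin_le v ht x _)⟩
  calc ‖x - (x - t • v i)‖ ^ 2 / 2 + t * phi v (x - t • v i)
      ≤ ‖x - (x - t • v i)‖ ^ 2 / 2 + t * inner ℝ (v i) (x - t • v i) := by
        gcongr
        exact phi_le v _ i
    _ = t * planeWaveMin v t x := by
        rw [norm_sub_sq_div_two_add_mul_inner, planeWaveMin, ← hi]
        simp

lemma u_eq_planeWaveMin (v : Fin 3 → Plane) {t : ℝ} (ht : 0 < t) : u v t = planeWaveMin v t := by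
  have scale : ∀ x y, ‖x - y‖ ^ 2 / (2 * t) + phi v y = (‖x - y‖ ^ 2 / 2 + t * phi v y) / t :=
    fun x y => by field_simp
  funext x
  refine IsLeast.csInf_eq ⟨?_, forall_mem_range.2 fun y => ?_⟩
  · obtain ⟨y, hy⟩ := exists_mul_planeWaveMin_eq v ht.le x
    exact ⟨y, by simp only [scale, hy, mul_div_cancel_left₀ _ ht.ne']⟩
  · rw [scale, le_div_iff₀' ht]
    exact mul_planeWaveMin_le v ht.le x y

lemma legendre_psi (v : Fin 3 → Plane) {t : ℝ} (ht : 0 ≤ t) :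
    legendre (psi v t) = fun x => ‖x‖ ^ 2 / 2 - t * planeWaveMin v t x := by
  have split : ∀ x y, inner ℝ x y - psi v t y =
      ‖x‖ ^ 2 / 2 - (‖x - y‖ ^ 2 / 2 + t * phi v y) := fun x y => by
    rw [psi, norm_sub_sq_real]
    ring
  funext x
  refine IsGreatest.csSup_eq ⟨?_, forall_mem_range.2 fun y => ?_⟩
  · obtain ⟨y, hy⟩ := exists_mul_planeWaveMin_eq v ht x
    exact ⟨y, by simp only [split, hy]⟩
  · rw [split]
    exact sub_le_sub_left (mul_planeWaveMin_le v ht x y) _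

end InitialPotential

/-! ### The viscous and the Lagrangian flow -/

section Flow

variable {v : Fin 3 → Plane} {ε t : ℝ}

lemma mass_inner (hε : 0 < ε) (ht : 0 < t) (q x : Plane) :
    mass (fun y => inner ℝ q y) ε t x =
      2 * Real.pi * ε * t * Real.exp (-(inner ℝ q x - t / 2 * ‖q‖ ^ 2) / ε) := by
  simpa using mass_affine hε ht 0 q x

lemma isBoundedSupergradient_inner (q : Plane) :
    IsBoundedSupergradient (fun y => inner ℝ q y) (fun _ => q) ‖q‖₊ := by
  simpa using isBoundedSupergradient_affine 0 q

lemma uVisc_le_planeWaveMin (v : Fin 3 → Plane) (hε : 0 < ε) (ht : 0 < t) (x : Plane) :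
    uVisc v ε t x ≤ planeWaveMin v t x := by
  obtain ⟨s, M, hs⟩ := exists_isBoundedSupergradient_phi v
  refine le_ciInf fun i => ?_
  have hexp : Real.exp (-(inner ℝ (v i) x - t / 2 * ‖v i‖ ^ 2) / ε) ≤
      (2 * Real.pi * ε * t)⁻¹ * mass (phi v) ε t x := by
    rw [le_inv_mul_iff₀ (by positivity), ← mass_inner hε ht]
    exact mass_anti hs (isBoundedSupergradient_inner (v i)) (phi_le v · i) hε ht x
  have hlog := (Real.le_log_iff_exp_le ((Real.exp_pos _).trans_le hexp)).2 hexp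
  rw [div_le_iff₀ hε] at hlog
  change -ε * Real.log ((2 * Real.pi * ε * t)⁻¹ * mass (phi v) ε t x) ≤ _
  linarith

lemma mass_phi_le (v : Fin 3 → Plane) (hε : 0 < ε) (ht : 0 < t) (x : Plane) :
    mass (phi v) ε t x ≤ ∑ i, mass (fun y => inner ℝ (v i) y) ε t x := by
  obtain ⟨s, M, hs⟩ := exists_isBoundedSupergradient_phi v
  have hint : ∀ i, Integrable (weight (fun y => inner ℝ (v i) y) ε t x) := fun i =>
    (isBoundedSupergradient_inner (v i)).integrable_weight hε ht x
  unfold mass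
  rw [← integral_finsetSum _ fun i _ => hint i]
  refine integral_mono (hs.integrable_weight hε ht x) (integrable_finsetSum _ fun i _ => hint i)
    fun y => ?_
  obtain ⟨i, hi⟩ := exists_phi_eq v y
  calc weight (phi v) ε t x y = weight (fun y => inner ℝ (v i) y) ε t x y := by
        rw [weight, weight, hi]
    _ ≤ ∑ j, weight (fun y => inner ℝ (v j) y) ε t x y :=
        Finset.single_le_sum (f := fun j => weight (fun y => inner ℝ (v j) y) ε t x y)
          (fun j _ => (weight_pos ..).le) (Finset.mem_univ i)

lemma planeWaveMin_sub_le_uVisc (v : Fin 3 → Plane) (hε : 0 < ε) (ht : 0 < t) (x : Plane) :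
    planeWaveMin v t x - ε * Real.log 3 ≤ uVisc v ε t x := by
  obtain ⟨s, M, hs⟩ := exists_isBoundedSupergradient_phi v
  have hm := hs.mass_pos hε ht x
  have hexp : (2 * Real.pi * ε * t)⁻¹ * mass (phi v) ε t x ≤
      3 * Real.exp (-planeWaveMin v t x / ε) := by
    rw [inv_mul_le_iff₀ (by positivity)]
    calc mass (phi v) ε t x ≤ ∑ i, mass (fun y => inner ℝ (v i) y) ε t x := mass_phi_le v hε ht x
      _ ≤ ∑ _i : Fin 3, 2 * Real.pi * ε * t * Real.exp (-planeWaveMin v t x / ε) := by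
          gcongr with i
          rw [mass_inner hε ht]
          gcongr
          exact planeWaveMin_le v t x i
      _ = 2 * Real.pi * ε * t * (3 * Real.exp (-planeWaveMin v t x / ε)) := by
          simp only [Finset.sum_const, Finset.card_univ, Fintype.card_fin, nsmul_eq_mul]
          ring
  have hlog := Real.log_le_log (by positivity) hexp
  rw [Real.log_mul three_ne_zero (Real.exp_pos _).ne', Real.log_exp, ← sub_le_iff_le_add',
    le_div_iff₀ hε] at hlog
  change _ ≤ -ε * Real.log ((2 * Real.pi * ε * t)⁻¹ * mass (phi v) ε t x)
  linarith

lemma gradient_uVisc_mem_superdifferential (v : Fin 3 → Plane) (hε : 0 < ε) (ht : 0 < t)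
    (x : Plane) : gradient (uVisc v ε t) x ∈ superdifferential (uVisc v ε t) x := by
  obtain ⟨s, M, hs⟩ := exists_isBoundedSupergradient_phi v
  have hc : 0 < (2 * Real.pi * ε * t)⁻¹ := by positivity
  have hgrad : HasGradientAt (uVisc v ε t) (drift (phi v) s ε t x) x :=
    hs.hasGradientAt_neg_mul_log_mass hε ht hc x
  rw [hgrad.gradient]
  exact hs.drift_mem_superdifferential hε ht hc x

theorem exists_isViscousFlow (v : Fin 3 → Plane) (hε : 0 < ε) : ∃ Y, IsViscousFlow v ε Y := by
  obtain ⟨s, M, hs⟩ := exists_isBoundedSupergradient_phi v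
  choose z hz₀ hz hz' using (hs.isDissipativeField_drift hε).exists_solution
  refine ⟨fun t y => z y t, fun y => ⟨hz₀ y, hz y, fun t ht => ?_⟩⟩
  have hgrad : HasGradientAt (uVisc v ε t) (drift (phi v) s ε t (z y t)) (z y t) :=
    hs.hasGradientAt_neg_mul_log_mass hε ht (by positivity) _
  rw [hgrad.gradient]
  exact hz' y t ht

lemma IsViscousFlow.norm_sub_sq_le {Y : ℝ → Plane → Plane} {f : ℝ → Plane → ℝ}
    {z p : ℝ → Plane} {y : Plane} {a b : ℝ} (hY : IsViscousFlow v ε Y) (hε : 0 < ε) (ht : 0 ≤ t)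
    (hz₀ : z 0 = y) (hz : ContinuousOn z (Ici 0))
    (hz' : ∀ s, 0 < s → HasDerivWithinAt z (p s) (Ici s) s)
    (hp : ∀ s, 0 < s → p s ∈ superdifferential (f s) (z s))
    (hfu : ∀ s, 0 < s → ∀ x, f s x ≤ uVisc v ε s x + a)
    (huf : ∀ s, 0 < s → ∀ x, uVisc v ε s x ≤ f s x + b) :
    ‖Y t y - z t‖ ^ 2 ≤ 2 * (a + b) * t := by
  simpa [(hY y).1, hz₀] using norm_sub_sq_le_of_inner_deriv_le (α := fun s => Y s y) (β := z)
    (C := a + b) ht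
    ((hY y).2.1.mono Icc_subset_Ici_self) (hz.mono Icc_subset_Ici_self)
    (fun s hs => ((hY y).2.2 s hs.1).hasDerivWithinAt) (fun s hs => hz' s hs.1)
    (fun s hs => inner_sub_le_of_mem_superdifferential
      (gradient_uVisc_mem_superdifferential v hε hs.1 _) (hp s hs.1) (hfu s hs.1) (huf s hs.1))

lemma IsViscousFlow.norm_sub_sq_le_of_isViscousFlow {δ : ℝ} {Y Z : ℝ → Plane → Plane}
    (hY : IsViscousFlow v ε Y) (hZ : IsViscousFlow v δ Z) (hε : 0 < ε) (hδ : 0 < δ)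
    (ht : 0 ≤ t) (y : Plane) :
    ‖Y t y - Z t y‖ ^ 2 ≤ 2 * (ε * Real.log 3 + δ * Real.log 3) * t :=
  hY.norm_sub_sq_le (z := fun s => Z s y) (p := fun s => gradient (uVisc v δ s) (Z s y))
    (f := uVisc v δ) hε ht (hZ y).1 (hZ y).2.1 (fun s hs => ((hZ y).2.2 s hs).hasDerivWithinAt)
    (fun s hs => gradient_uVisc_mem_superdifferential v hδ hs _)
    (fun s hs x => by
      linarith [uVisc_le_planeWaveMin v hδ hs x, planeWaveMin_sub_le_uVisc v hε hs x])
    (fun s hs x => by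
      linarith [uVisc_le_planeWaveMin v hε hs x, planeWaveMin_sub_le_uVisc v hδ hs x])

lemma IsViscousFlow.norm_sub_le {Y : ℝ → Plane → Plane} (hY : IsViscousFlow v ε Y)
    (hε : 0 < ε) {s : ℝ} (hs : 0 ≤ s) (hst : s ≤ t) (y z : Plane) :
    ‖Y t y - Y t z‖ ≤ ‖Y s y - Y s z‖ := by
  have hsub : Icc s t ⊆ Ici 0 := fun r hr => hs.trans hr.1
  have hpos : ∀ r ∈ Ioo s t, 0 < r := fun r hr => hs.trans_lt hr.1
  exact norm_sub_le_of_inner_deriv_nonpos (α := fun r => Y r y) (β := fun r => Y r z)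
    (p := fun r => gradient (uVisc v ε r) (Y r y)) (q := fun r => gradient (uVisc v ε r) (Y r z))
    hst ((hY y).2.1.mono hsub) ((hY z).2.1.mono hsub)
    (fun r hr => ((hY y).2.2 r (hpos r hr)).hasDerivWithinAt)
    (fun r hr => ((hY z).2.2 r (hpos r hr)).hasDerivWithinAt)
    (fun r hr => inner_sub_nonpos_of_mem_superdifferential
      (gradient_uVisc_mem_superdifferential v hε (hpos r hr) _)
      (gradient_uVisc_mem_superdifferential v hε (hpos r hr) _))

lemma tendsto_sqrt_mul_log_nhdsGT_zero (k t : ℝ) :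
    Tendsto (fun ε => √(k * (ε * Real.log 3) * t)) (𝓝[>] 0) (𝓝 0) := by
  have hcont : Continuous fun ε => √(k * (ε * Real.log 3) * t) := by fun_prop
  simpa using (hcont.tendsto 0).mono_left nhdsWithin_le_nhds

theorem exists_isLagrangianFlow (v : Fin 3 → Plane) : ∃ X, IsLagrangianFlow v X := by
  choose! Y hY using fun ε (hε : 0 < ε) => exists_isViscousFlow v hε
  have hlim : ∀ t, 0 ≤ t → ∀ y, ∃ x, Tendsto (fun ε => Y ε t y) (𝓝[>] 0) (𝓝 x) := by
    intro t ht y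
    refine exists_tendsto_nhdsGT_of_dist_le (tendsto_sqrt_mul_log_nhdsGT_zero 4 t)
      (eventually_mem_nhdsWithin.mono fun δ (hδ : 0 < δ) ε hε => ?_)
    rw [dist_eq_norm]
    refine Real.le_sqrt_of_sq_le (((hY ε hε.1).norm_sub_sq_le_of_isViscousFlow (hY δ hδ)
      hε.1 hδ ht y).trans (mul_le_mul_of_nonneg_right ?_ ht))
    have := mul_le_mul_of_nonneg_right hε.2 (Real.log_nonneg (by norm_num : (1 : ℝ) ≤ 3))
    linarith
  choose! X hX using hlim
  exact ⟨X, Y, hY, hX⟩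

theorem IsLagrangianFlow.eq_of_inclusion {X : ℝ → Plane → Plane} (hX : IsLagrangianFlow v X)
    {y : Plane} {z p : ℝ → Plane} (hz₀ : z 0 = y) (hz : ContinuousOn z (Ici 0))
    (hz' : ∀ t, 0 < t → HasDerivWithinAt z (p t) (Ici t) t)
    (hp : ∀ t, 0 < t → p t ∈ superdifferential (u v t) (z t)) (ht : 0 ≤ t) : z t = X t y := by
  obtain ⟨Y, hY, hlim⟩ := hX
  refine tendsto_nhds_unique ?_ (hlim t ht y)
  refine tendsto_iff_norm_sub_tendsto_zero.2 (squeeze_zero'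
    (Eventually.of_forall fun _ => norm_nonneg _)
    (eventually_mem_nhdsWithin.mono fun ε (hε : 0 < ε) => Real.le_sqrt_of_sq_le ?_)
    (tendsto_sqrt_mul_log_nhdsGT_zero 2 t))
  have hfu : ∀ s, 0 < s → ∀ x, u v s x ≤ uVisc v ε s x + ε * Real.log 3 := fun s hs x => by
    rw [u_eq_planeWaveMin v hs]
    linarith [planeWaveMin_sub_le_uVisc v hε hs x]
  have huf : ∀ s, 0 < s → ∀ x, uVisc v ε s x ≤ u v s x + 0 := fun s hs x => by
    rw [u_eq_planeWaveMin v hs, add_zero]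
    exact uVisc_le_planeWaveMin v hε hs x
  simpa using (hY ε hε).norm_sub_sq_le hε ht hz₀ hz hz' hp hfu huf

theorem IsLagrangianFlow.isSticky {X : ℝ → Plane → Plane} (hX : IsLagrangianFlow v X) :
    IsSticky X := by
  obtain ⟨Y, hY, hlim⟩ := hX
  intro s t hs hst y z hmeet
  have ht := hs.trans hst
  have contraction : ‖X t y - X t z‖ ≤ ‖X s y - X s z‖ :=
    le_of_tendsto_of_tendsto ((hlim t ht y).sub (hlim t ht z)).norm
      ((hlim s hs y).sub (hlim s hs z)).norm
      (eventually_mem_nhdsWithin.mono fun ε hε => (hY ε hε).norm_sub_le hε hs hst y z)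
  rw [hmeet, sub_self, norm_zero] at contraction
  exact sub_eq_zero.1 (norm_le_zero_iff.1 contraction)

end Flow

/-! ### Faces of the triangle and the circumcenter -/

section Face

variable {v : Fin 3 → Plane}

lemma face_zero (v : Fin 3 → Plane) : face v 0 = convexHull ℝ (range v) := by
  simp only [face, inner_zero_right, phi_zero, and_true, ofPred_mem_eq]

lemma face_smul (v : Fin 3 → Plane) {r : ℝ} (hr : 0 < r) (y : Plane) :
    face v (r • y) = face v y := by
  simp only [face, inner_smul_right, phi_smul v hr.le, mul_right_inj' hr.ne']

lemma convex_face (v : Fin 3 → Plane) (y : Plane) : Convex ℝ (face v y) :=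
  (convex_convexHull ℝ _).inter (convex_hyperplane (f := fun q : Plane => inner ℝ q y)
    ⟨fun _ _ => inner_add_left _ _ _, fun _ _ => real_inner_smul_left _ _ _⟩ (phi v y))

lemma exists_mem_face_sub (v : Fin 3 → Plane) (p : Plane) : ∃ q, q ∈ face v (q - p) := by
  obtain ⟨q, hq, hmin⟩ := exists_mem_forall_inner_sub_nonneg
    ((range_nonempty v).mono (subset_convexHull ℝ _))
    ((finite_range v).isCompact_convexHull ℝ).isComplete (convex_convexHull ℝ _) p
  obtain ⟨i, hi⟩ := exists_phi_eq v (q - p)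
  have hqi := hmin _ (subset_convexHull ℝ _ (mem_range_self i))
  rw [real_inner_comm, inner_sub_left, ← hi] at hqi
  exact ⟨q, hq, le_antisymm (sub_nonneg.1 hqi) (phi_le_inner_of_mem_convexHull hq _)⟩

lemma mem_convexHull_of_forall_phi_le {c : Plane} (hc : ∀ y, phi v y ≤ inner ℝ c y) :
    c ∈ convexHull ℝ (range v) := by
  obtain ⟨q, hq⟩ := exists_mem_face_sub v c
  have hle : inner ℝ (q - c) (q - c) ≤ (0 : ℝ) := by
    rw [inner_sub_left, hq.2]
    exact sub_nonpos.2 (hc _)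
  rw [← sub_eq_zero.1 (real_inner_self_nonpos.1 hle)]
  exact hq.1

section Direction

variable {w d : Plane} {a : ℝ}

lemma eventually_phi_add_smul (hd : ∀ k, inner ℝ (v k) w = phi v w → inner ℝ (v k) d = a) :
    ∀ᶠ r in 𝓝 0, phi v (w + r • d) = phi v w + r * a := by
  have lower : ∀ k, ∀ᶠ r in 𝓝 (0 : ℝ), phi v w + r * a ≤ inner ℝ (v k) (w + r • d) := by
    intro k
    rcases (phi_le v w k).eq_or_lt with hk | hk
    · refine .of_forall fun r => ?_
      rw [inner_add_right, inner_smul_right, hd k hk.symm, hk]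
    · have hleft : ContinuousAt (fun r : ℝ => phi v w + r * a) 0 := by fun_prop
      have hright : ContinuousAt (fun r : ℝ => (inner ℝ (v k) (w + r • d) : ℝ)) 0 := by fun_prop
      exact (hleft.eventually_lt hright (by simpa using hk)).mono fun r => le_of_lt
  obtain ⟨i, hi⟩ := exists_phi_eq v w
  filter_upwards [eventually_all.2 lower] with r hr
  refine le_antisymm ((phi_le v _ i).trans_eq ?_) (le_ciInf hr)
  rw [inner_add_right, inner_smul_right, hd i hi.symm, hi]

-- Moving in both directions `d` and `-d` forces `⟪q, d⟫ = a` for every point `q` of the face.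
lemma eventually_face_subset (hd : ∀ k, inner ℝ (v k) w = phi v w → inner ℝ (v k) d = a) :
    ∀ᶠ r in 𝓝 (0 : ℝ), face v w ⊆ face v (w + r • d) := by
  have hphi := eventually_phi_add_smul hd
  have hneg : Tendsto (fun r : ℝ => -r) (𝓝 0) (𝓝 0) := continuous_neg.tendsto' 0 0 neg_zero
  filter_upwards [hphi, hneg.eventually hphi] with r hr hr' q hq
  have lower := phi_le_inner_of_mem_convexHull hq.1 (w + -r • d)
  have upper := phi_le_inner_of_mem_convexHull hq.1 (w + r • d)
  refine ⟨hq.1, le_antisymm ?_ upper⟩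
  rw [hr', inner_add_right, inner_smul_right, hq.2] at lower
  rw [hr, inner_add_right, inner_smul_right, hq.2]
  linarith

end Direction

variable {c : Plane}

lemma planeWaveMin_eq_phi_add (hc : ∀ i j, dist (v i) c = dist (v j) c) (t : ℝ) (x : Plane) :
    planeWaveMin v t x = phi v (x - t • c) + t * ((‖c‖ ^ 2 - dist (v 0) c ^ 2) / 2) := by
  rw [phi, ciInf_add (finite_range _).bddBelow]
  refine congrArg iInf (funext fun i => ?_)
  rw [hc 0 i, dist_eq_norm, norm_sub_sq_real, inner_sub_right, inner_smul_right]
  ring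

lemma face_subset_superdifferential_planeWaveMin (hc : ∀ i j, dist (v i) c = dist (v j) c)
    (t : ℝ) (x : Plane) : face v (x - t • c) ⊆ superdifferential (planeWaveMin v t) x :=
  fun q hq z => by
    have := face_subset_superdifferential v _ hq (z - t • c)
    rw [sub_sub_sub_cancel_right] at this
    rw [planeWaveMin_eq_phi_add hc, planeWaveMin_eq_phi_add hc]
    linarith

end Face

/-! ### The transport map -/

section TransportMap

variable {v : Fin 3 → Plane} {c y : Plane} {s t : ℝ}

lemma lipschitzWith_of_sub_self_mem_superdifferential {g : Plane → ℝ} {R : Plane → Plane}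
    (hR : ∀ y, R y - y ∈ superdifferential g (R y)) : LipschitzWith 1 R := by
  refine .of_dist_le_mul fun y z => ?_
  have hmono := inner_sub_nonpos_of_mem_superdifferential (hR y) (hR z)
  rw [sub_sub_sub_comm, inner_sub_left, real_inner_self_eq_norm_sq, sub_nonpos] at hmono
  rw [dist_eq_norm, dist_eq_norm, NNReal.coe_one, one_mul]
  by_contra! hlt
  nlinarith [real_inner_le_norm (y - z) (R y - R z), norm_nonneg (y - z)]

lemma hasGradientAt_legendre_sq_norm_sub {g : Plane → ℝ} {R : Plane → Plane}
    (hR : ∀ y, R y - y ∈ superdifferential g (R y)) (y : Plane) :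
    HasGradientAt (legendre fun x => ‖x‖ ^ 2 / 2 - g x) (R y) y := by
  have hmax : ∀ y, IsGreatest (range fun x => inner ℝ y x - (‖x‖ ^ 2 / 2 - g x))
      (inner ℝ y (R y) - (‖R y‖ ^ 2 / 2 - g (R y))) := fun y => by
    refine ⟨mem_range_self (R y), forall_mem_range.2 fun x => ?_⟩
    have hx := hR y x
    have hsq := norm_sub_sq_real x (R y)
    rw [inner_sub_left, inner_sub_right, inner_sub_right, real_inner_self_eq_norm_sq,
      real_inner_comm] at hx
    linarith [sq_nonneg ‖x - R y‖]
  have hval : ∀ y, legendre (fun x => ‖x‖ ^ 2 / 2 - g x) y =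
      inner ℝ y (R y) - (‖R y‖ ^ 2 / 2 - g (R y)) := fun y => (hmax y).csSup_eq
  have hneg : HasGradientAt (fun y => -legendre (fun x => ‖x‖ ^ 2 / 2 - g x) y) (-R y) y := by
    refine hasGradientAt_of_mem_superdifferential (q := fun y => -R y) (fun x z => ?_)
      (lipschitzWith_of_sub_self_mem_superdifferential hR).continuous.neg.continuousAt
    have hz := (hmax z).2 (mem_range_self (R x))
    rw [hval, hval, inner_neg_left, inner_sub_right, real_inner_comm z, real_inner_comm x]
    linarith
  rw [hasGradientAt_iff_hasFDerivAt] at hneg ⊢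
  simpa using hneg.fun_neg

/-- The optimality condition for the velocity `q` with which the transport map moves `y` to
`y + t • q`, in terms of the circumcenter `c`. The velocity is unique only for `t ≠ 0`. -/
def IsTransportVelocity (v : Fin 3 → Plane) (c : Plane) (t : ℝ) (y q : Plane) : Prop :=
  q ∈ face v (y + t • (q - c))

lemma exists_isTransportVelocity (v : Fin 3 → Plane) (c : Plane) (ht : 0 ≤ t) (y : Plane) :
    ∃ q, IsTransportVelocity v c t y q := by
  rcases ht.eq_or_lt with rfl | ht
  · obtain ⟨i, hi⟩ := exists_phi_eq v y
    refine ⟨v i, ?_⟩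
    rw [IsTransportVelocity, zero_smul, add_zero]
    exact mem_face_of_inner_eq_phi hi.symm
  · obtain ⟨q, hq⟩ := exists_mem_face_sub v (c - t⁻¹ • y)
    refine ⟨q, ?_⟩
    have hsmul : y + t • (q - c) = t • (q - (c - t⁻¹ • y)) := by
      simp only [smul_sub, smul_inv_smul₀ ht.ne']
      abel
    rwa [IsTransportVelocity, hsmul, face_smul v ht]

lemma IsTransportVelocity.mul_norm_sub_le {q r : Plane} (hq : IsTransportVelocity v c t y q)
    (hr : IsTransportVelocity v c s y r) : t * ‖q - r‖ ≤ |t - s| * ‖r - c‖ := by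
  have hmono := inner_sub_nonpos_of_mem_superdifferential
    (face_subset_superdifferential v _ hq) (face_subset_superdifferential v _ hr)
  have hsplit : y + t • (q - c) - (y + s • (r - c)) = t • (q - r) + (t - s) • (r - c) := by module
  rw [hsplit, inner_add_right, inner_smul_right, real_inner_self_eq_norm_sq] at hmono
  have hcs := neg_le_of_abs_le (abs_real_inner_le_norm (q - r) ((t - s) • (r - c)))
  rw [norm_smul, Real.norm_eq_abs] at hcs
  rcases (norm_nonneg (q - r)).eq_or_lt with hqr | hqr
  · rw [← hqr, mul_zero]
    positivity
  · refine le_of_mul_le_mul_right ?_ hqr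
    linarith

lemma IsTransportVelocity.norm_smul_sub_smul_le {q r : Plane} (ht : 0 ≤ t)
    (hq : IsTransportVelocity v c t y q) (hr : IsTransportVelocity v c s y r) :
    ‖t • q - s • r‖ ≤ |t - s| * (‖r - c‖ + ‖r‖) :=
  calc ‖t • q - s • r‖ = ‖t • (q - r) + (t - s) • r‖ := by
        congr 1
        module
    _ ≤ t * ‖q - r‖ + |t - s| * ‖r‖ := by
        refine (norm_add_le _ _).trans_eq ?_
        rw [norm_smul, norm_smul, Real.norm_of_nonneg ht, Real.norm_eq_abs]
    _ ≤ |t - s| * (‖r - c‖ + ‖r‖) := by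
        rw [mul_add]
        exact add_le_add_left (hq.mul_norm_sub_le hr) _

lemma IsTransportVelocity.T_eq {q : Plane} (hc : ∀ i j, dist (v i) c = dist (v j) c) (ht : 0 ≤ t)
    (hq : IsTransportVelocity v c t y q) : T v t y = y + t • q := by
  choose r hr using exists_isTransportVelocity v c ht
  have hgrad : HasGradientAt (legendre (legendre (psi v t))) (y + t • r y) y := by
    rw [legendre_psi v ht]
    refine hasGradientAt_legendre_sq_norm_sub (R := fun y => y + t • r y) (fun y => ?_) y
    rw [add_sub_cancel_left]
    refine smul_mem_superdifferential ht (face_subset_superdifferential_planeWaveMin hc t _ ?_)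
    rw [add_sub_assoc, ← smul_sub]
    exact hr y
  have hunique : ‖t • r y - t • q‖ ≤ 0 := by
    simpa using (hr y).norm_smul_sub_smul_le ht hq
  rw [T, hgrad.gradient, sub_eq_zero.1 (norm_le_zero_iff.1 hunique)]

lemma T_zero (hc : ∀ i j, dist (v i) c = dist (v j) c) (y : Plane) : T v 0 y = y := by
  obtain ⟨q, hq⟩ := exists_isTransportVelocity v c le_rfl y
  rw [hq.T_eq hc le_rfl, zero_smul, add_zero]

lemma continuousOn_T (hc : ∀ i j, dist (v i) c = dist (v j) c) (y : Plane) :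
    ContinuousOn (fun t => T v t y) (Ici 0) := by
  intro s hs
  obtain ⟨r, hr⟩ := exists_isTransportVelocity v c hs y
  have hbound : Continuous fun t => |t - s| * (‖r - c‖ + ‖r‖) := by fun_prop
  rw [ContinuousWithinAt, tendsto_iff_norm_sub_tendsto_zero]
  refine squeeze_zero' (.of_forall fun t => norm_nonneg _)
    (eventually_mem_nhdsWithin.mono fun t ht => ?_)
    ((hbound.tendsto' s 0 (by simp)).mono_left nhdsWithin_le_nhds)
  obtain ⟨q, hq⟩ := exists_isTransportVelocity v c ht y
  rw [hq.T_eq hc ht, hr.T_eq hc hs, add_sub_add_left_eq_sub]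
  exact hq.norm_smul_sub_smul_le ht hr

end TransportMap

/-! ### The transport velocity -/

section TransportVelocity

variable {v : Fin 3 → Plane} {c : Plane} {t : ℝ} {x : Plane}

lemma vectorSpan_range_eq_top (hv : AffineIndependent ℝ v) : vectorSpan ℝ (range v) = ⊤ :=
  hv.vectorSpan_eq_top_of_card_eq_finrank_add_one (by simp)

lemma dist_center_eq (hv : AffineIndependent ℝ v) (i j : Fin 3) :
    dist (v i) (center v hv) = dist (v j) (center v hv) :=
  ((⟨v, hv⟩ : Affine.Simplex ℝ Plane 2).dist_circumcenter_eq_circumradius i).trans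
    ((⟨v, hv⟩ : Affine.Simplex ℝ Plane 2).dist_circumcenter_eq_circumradius j).symm

lemma ray_comm (v : Fin 3 → Plane) (i j : Fin 3) : ray v i j = ray v j i := by
  ext y
  constructor <;> exact fun h => ⟨h.1.symm, fun k hki hkj => h.1 ▸ h.2 k hkj hki⟩

-- `ray v i i` is the open sector on which `v i` alone minimizes the inner product.
lemma mem_sector_iff_mem_rayAt (hc : ∀ i j, dist (v i) c = dist (v j) c) (ht : 0 < t)
    {i : Fin 3} : x ∈ sector v t i ↔ x ∈ rayAt v c t i i := by
  have expand : ∀ k, ‖x - t • v k‖ ^ 2 = ‖x‖ ^ 2 - t ^ 2 * (‖c‖ ^ 2 - dist (v 0) c ^ 2) -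
      2 * t * inner ℝ (v k) (x - t • c) := fun k => by
    rw [hc 0 k, dist_eq_norm, norm_sub_sq_real, norm_sub_sq_real, inner_sub_right,
      inner_smul_right, inner_smul_right, norm_smul, real_inner_comm x, Real.norm_of_nonneg ht.le]
    ring
  simp only [sector, rayAt, ray, mem_ofPred_eq, expand, sub_lt_sub_iff_left, true_and,
    mul_lt_mul_iff_right₀ (mul_pos two_pos ht)]
  exact ⟨fun h k hk _ => h k hk, fun h k hk => h k hk hk⟩

lemma eq_zero_or_exists_mem_ray (hv : AffineIndependent ℝ v) (w : Plane) :
    w = 0 ∨ ∃ i j, w ∈ ray v i j := by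
  by_cases heq : ∀ k, inner ℝ (v k) w = phi v w
  · refine .inl (eq_zero_of_forall_inner_eq (vectorSpan_range_eq_top hv) ?_)
    rintro _ ⟨i, rfl⟩ _ ⟨j, rfl⟩
    rw [heq, heq]
  push Not at heq
  obtain ⟨k, hk⟩ := heq
  obtain ⟨i, hi⟩ := exists_phi_eq v w
  have hlt := (phi_le v w k).lt_of_ne hk.symm
  rw [hi] at hlt
  have hik : i ≠ k := fun h => hlt.ne (h ▸ rfl)
  obtain ⟨j, hj⟩ := (by decide : ∀ i k : Fin 3, i ≠ k → ∃ j, ∀ l, l = i ∨ l = j ∨ l = k) i k hik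
  rcases (phi_le v w j).eq_or_lt with hij | hij <;> rw [hi] at hij
  · refine .inr ⟨i, j, hij, fun l hli hlj => ?_⟩
    rwa [((hj l).resolve_left hli).resolve_left hlj]
  · refine .inr ⟨i, i, rfl, fun l hli _ => ?_⟩
    rcases (hj l).resolve_left hli with rfl | rfl <;> assumption

lemma inner_eq_phi_of_mem_ray {w : Plane} {i j : Fin 3} (h : w ∈ ray v i j) :
    inner ℝ (v i) w = phi v w := by
  refine le_antisymm (le_ciInf fun k => ?_) (phi_le v w i)
  rcases eq_or_ne k i with rfl | hki
  · rfl
  rcases eq_or_ne k j with rfl | hkj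
  · exact h.1.le
  · exact (h.2 k hki hkj).le

lemma midpoint_mem_face_of_mem_ray {w : Plane} {i j : Fin 3} (h : w ∈ ray v i j) :
    midpoint ℝ (v i) (v j) ∈ face v w := by
  have hi := inner_eq_phi_of_mem_ray h
  exact (convex_face v w).midpoint_mem (mem_face_of_inner_eq_phi hi)
    (mem_face_of_inner_eq_phi (h.1.symm.trans hi))

lemma V_eq_or_exists_mem_rayAt (hv : AffineIndependent ℝ v)
    (hc : ∀ i j, dist (v i) c = dist (v j) c) (ht : 0 < t) (x : Plane) :
    (x = t • c ∧ V v c t x = c) ∨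
      ∃ i j, x ∈ rayAt v c t i j ∧ V v c t x = midpoint ℝ (v i) (v j) := by
  unfold V
  split_ifs with h₀ h₁ h₂ h₀₁ h₁₂ h₂₀
  · exact .inr ⟨0, 0, (mem_sector_iff_mem_rayAt hc ht).1 h₀, (midpoint_self ..).symm⟩
  · exact .inr ⟨1, 1, (mem_sector_iff_mem_rayAt hc ht).1 h₁, (midpoint_self ..).symm⟩
  · exact .inr ⟨2, 2, (mem_sector_iff_mem_rayAt hc ht).1 h₂, (midpoint_self ..).symm⟩
  · exact .inr ⟨0, 1, h₀₁, rfl⟩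
  · exact .inr ⟨1, 2, h₁₂, rfl⟩
  · exact .inr ⟨2, 0, h₂₀, rfl⟩
  refine .inl ⟨?_, rfl⟩
  rcases eq_zero_or_exists_mem_ray hv (x - t • c) with hx | ⟨i, j, hij⟩
  · exact sub_eq_zero.1 hx
  · have hji := ray_comm v i j ▸ hij
    rw [mem_sector_iff_mem_rayAt hc ht] at h₀ h₁ h₂
    fin_cases i <;> fin_cases j <;> contradiction

lemma V_smul_center (hv : AffineIndependent ℝ v) (hc : ∀ i j, dist (v i) c = dist (v j) c)
    (ht : 0 < t) : V v c t (t • c) = c := by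
  rcases V_eq_or_exists_mem_rayAt hv hc ht (t • c) with ⟨-, hV⟩ | ⟨i, j, hij, -⟩
  · exact hV
  · obtain ⟨k, hki, hkj⟩ : ∃ k, k ≠ i ∧ k ≠ j :=
      (by decide : ∀ i j : Fin 3, ∃ k, k ≠ i ∧ k ≠ j) i j
    simpa using hij.2 k hki hkj

lemma inner_V_eq_phi (hv : AffineIndependent ℝ v) (hc : ∀ i j, dist (v i) c = dist (v j) c)
    (ht : 0 < t) (x : Plane) : inner ℝ (V v c t x) (x - t • c) = phi v (x - t • c) := by
  rcases V_eq_or_exists_mem_rayAt hv hc ht x with ⟨rfl, -⟩ | ⟨i, j, hij, hV⟩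
  · rw [sub_self, inner_zero_right, phi_zero]
  · rw [hV]
    exact (midpoint_mem_face_of_mem_ray hij).2

lemma V_mem_face (hv : AffineIndependent ℝ v) (hc : ∀ i j, dist (v i) c = dist (v j) c)
    (hcv : c ∈ convexHull ℝ (range v)) (ht : 0 < t) (x : Plane) :
    V v c t x ∈ face v (x - t • c) := by
  refine ⟨?_, inner_V_eq_phi hv hc ht x⟩
  rcases V_eq_or_exists_mem_rayAt hv hc ht x with ⟨-, hV⟩ | ⟨i, j, hij, hV⟩ <;> rw [hV]
  · exact hcv
  · exact (midpoint_mem_face_of_mem_ray hij).1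

-- `V - c` is orthogonal to the minimizing edge, since `c` lies on its perpendicular bisector.
lemma exists_inner_V_sub_center_eq (hv : AffineIndependent ℝ v)
    (hc : ∀ i j, dist (v i) c = dist (v j) c) (ht : 0 < t) (x : Plane) :
    ∃ a, ∀ k, inner ℝ (v k) (x - t • c) = phi v (x - t • c) →
      inner ℝ (v k) (V v c t x - c) = a := by
  rcases V_eq_or_exists_mem_rayAt hv hc ht x with ⟨-, hV⟩ | ⟨i, j, hij, hV⟩
  · exact ⟨0, fun k _ => by rw [hV, sub_self, inner_zero_right]⟩
  refine ⟨inner ℝ (v i) (V v c t x - c), fun k hk => ?_⟩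
  rw [hV]
  rcases eq_or_ne k i with rfl | hki
  · rfl
  rcases eq_or_ne k j with rfl | hkj
  · have hbis : c ∈ AffineSubspace.perpBisector (v i) (v k) :=
      AffineSubspace.mem_perpBisector_iff_dist_eq'.2 (hc i k)
    rw [AffineSubspace.mem_perpBisector_iff_inner_eq_zero, vsub_eq_sub, vsub_eq_sub] at hbis
    rw [← sub_eq_zero, ← inner_sub_left, ← neg_sub c, inner_neg_right, real_inner_comm, hbis,
      neg_zero]
  · exact absurd (hk.trans (inner_eq_phi_of_mem_ray hij).symm) (hij.2 k hki hkj).ne'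

theorem V_mem_differential (hv : AffineIndependent ℝ v)
    (hc : ∀ i j, dist (v i) c = dist (v j) c) (hcv : c ∈ convexHull ℝ (range v)) (ht : 0 < t)
    (x : Plane) : V v c t x ∈ differential 0 (u v t) x := by
  rw [differential_zero, u_eq_planeWaveMin v ht]
  exact face_subset_superdifferential_planeWaveMin hc t x (V_mem_face hv hc hcv ht x)

theorem oneSidedLipschitz_of_mem_differential {W : Plane → Plane} {f : Plane → ℝ}
    (hW : ∀ x, W x ∈ differential 0 f x) : OneSidedLipschitz W := by
  simp only [differential_zero] at hW
  exact ⟨0, le_rfl, fun x z => by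
    simpa using inner_sub_nonpos_of_mem_superdifferential (hW x) (hW z)⟩

theorem mem_convexHull_of_oneSidedLipschitz_V (hv : AffineIndependent ℝ v)
    (hc : ∀ i j, dist (v i) c = dist (v j) c) (ht : 0 < t) (hV : OneSidedLipschitz (V v c t)) :
    c ∈ convexHull ℝ (range v) := by
  obtain ⟨l, -, hl⟩ := hV
  refine mem_convexHull_of_forall_phi_le fun y => sub_nonpos.1 ?_
  have hlim : Tendsto (fun r : ℝ => l * r * ‖y‖ ^ 2) (𝓝[>] 0) (𝓝 0) :=
    (Continuous.tendsto' (by fun_prop) 0 0 (by simp)).mono_left nhdsWithin_le_nhds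
  refine ge_of_tendsto hlim (eventually_mem_nhdsWithin.mono fun r (hr : 0 < r) => ?_)
  have hphi := inner_V_eq_phi hv hc ht (t • c + r • y)
  have hlr := hl (t • c + r • y) (t • c)
  rw [add_sub_cancel_left] at hphi hlr
  rw [V_smul_center hv hc ht, inner_sub_left, hphi, phi_smul v hr.le, inner_smul_right, norm_smul,
    Real.norm_of_nonneg hr.le] at hlr
  refine le_of_mul_le_mul_left ?_ hr
  linarith

end TransportVelocity

/-! ### The transport map as a flow -/

section TransportFlow

variable {v : Fin 3 → Plane} {c : Plane} {t : ℝ}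

lemma eventually_T_eq (hv : AffineIndependent ℝ v) (hc : ∀ i j, dist (v i) c = dist (v j) c)
    (hcv : c ∈ convexHull ℝ (range v)) (ht : 0 < t) (y : Plane) :
    ∀ᶠ s in 𝓝[≥] t, T v s y = T v t y + (s - t) • V v c t (T v t y) := by
  obtain ⟨q, hq⟩ := exists_isTransportVelocity v c ht.le y
  have hT := hq.T_eq hc ht.le
  have hw : y + t • (q - c) = T v t y - t • c := by rw [hT, smul_sub, add_sub_assoc]
  obtain ⟨a, ha⟩ := exists_inner_V_sub_center_eq hv hc ht (T v t y)
  have hm := V_mem_face hv hc hcv ht (T v t y)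
  rw [IsTransportVelocity, hw] at hq
  set m := V v c t (T v t y)
  have hsub : Tendsto (fun s => s - t) (𝓝[≥] t) (𝓝 0) :=
    ((continuous_sub_right t).tendsto' t 0 (sub_self t)).mono_left nhdsWithin_le_nhds
  filter_upwards [hsub.eventually (eventually_face_subset ha), self_mem_nhdsWithin]
    with s hface (hs : t ≤ s)
  have hs₀ : 0 < s := ht.trans_le hs
  set p := (t / s) • q + ((s - t) / s) • m with hp
  have hsp : s • p = t • q + (s - t) • m := by
    rw [hp, smul_add, smul_smul, smul_smul, mul_div_cancel₀ _ hs₀.ne', mul_div_cancel₀ _ hs₀.ne']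
  have hpface : p ∈ face v (T v t y - t • c) := by
    refine convex_face v _ hq hm (by positivity) (div_nonneg (sub_nonneg.2 hs) hs₀.le) ?_
    rw [← add_div, add_sub_cancel, div_self hs₀.ne']
  have hpT : IsTransportVelocity v c s y p := by
    have hmove : y + s • (p - c) = T v t y - t • c + (s - t) • (m - c) := by
      rw [smul_sub, hsp, hT]
      module
    rw [IsTransportVelocity, hmove]
    exact hface hpface
  rw [hpT.T_eq hc hs₀.le, hsp, hT, add_assoc]

lemma hasDerivWithinAt_T (hv : AffineIndependent ℝ v) (hc : ∀ i j, dist (v i) c = dist (v j) c)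
    (hcv : c ∈ convexHull ℝ (range v)) (ht : 0 < t) (y : Plane) :
    HasDerivWithinAt (fun s => T v s y) (V v c t (T v t y)) (Ici t) t := by
  have hlinear : HasDerivAt (fun s => T v t y + (s - t) • V v c t (T v t y))
      (V v c t (T v t y)) t := by
    simpa using (((hasDerivAt_id t).sub_const t).smul_const (V v c t (T v t y))).const_add (T v t y)
  exact hlinear.hasDerivWithinAt.congr_of_eventuallyEq (eventually_T_eq hv hc hcv ht y) (by simp)

theorem T_eq_of_mem_convexHull (hv : AffineIndependent ℝ v)
    (hc : ∀ i j, dist (v i) c = dist (v j) c) (hcv : c ∈ convexHull ℝ (range v))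
    {X : ℝ → Plane → Plane} (hX : IsLagrangianFlow v X) (ht : 0 ≤ t) (y : Plane) :
    T v t y = X t y :=
  hX.eq_of_inclusion (z := fun t => T v t y) (p := fun t => V v c t (T v t y)) (T_zero hc y)
    (continuousOn_T hc y) (fun _ hs => hasDerivWithinAt_T hv hc hcv hs y)
    (fun s hs => differential_zero (u v s) _ ▸ V_mem_differential hv hc hcv hs _) ht

-- All points `c - p` with `p` in the triangle meet at `c` at time one. If `c` is outside, the one
-- with `p` closest to `c` cannot keep company with all three vertices `p = v i` up to time two.
theorem mem_convexHull_of_isSticky_T (hv : AffineIndependent ℝ v)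
    (hc : ∀ i j, dist (v i) c = dist (v j) c) (hT : IsSticky (T v)) :
    c ∈ convexHull ℝ (range v) := by
  have meet : ∀ p ∈ convexHull ℝ (range v), T v 1 (c - p) = c := fun p hp => by
    have hp₁ : IsTransportVelocity v c 1 (c - p) p := by
      rwa [IsTransportVelocity, one_smul, sub_add_sub_cancel, sub_self, face_zero]
    rw [hp₁.T_eq hc zero_le_one, one_smul, sub_add_cancel]
  obtain ⟨q, hq⟩ := exists_mem_face_sub v c
  have hq₂ : IsTransportVelocity v c 2 (c - q) q := by
    have : c - q + (2 : ℝ) • (q - c) = q - c := by module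
    rwa [IsTransportVelocity, this]
  have hvq : ∀ i, inner ℝ (v i) (q - c) = phi v (q - c) := fun i => by
    have hvi := subset_convexHull ℝ _ (mem_range_self (f := v) i)
    obtain ⟨p, hp⟩ := exists_isTransportVelocity v c zero_le_two (c - v i)
    have htogether := hT 1 2 zero_le_one one_le_two (c - v i) (c - q)
      ((meet _ hvi).trans (meet _ hq.1).symm)
    rw [hp.T_eq hc zero_le_two, hq₂.T_eq hc zero_le_two] at htogether
    have hvi_eq : v i = (2 : ℝ) • p - q := by
      linear_combination (norm := module) -htogether
    have hpos : c - v i + (2 : ℝ) • (p - c) = q - c := by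
      rw [hvi_eq]
      module
    rw [IsTransportVelocity, hpos] at hp
    rw [hvi_eq, inner_sub_left, real_inner_smul_left, hp.2, hq.2]
    ring
  have hqc := eq_zero_of_forall_inner_eq (vectorSpan_range_eq_top hv) (w := q - c) <| by
    rintro _ ⟨i, rfl⟩ _ ⟨j, rfl⟩
    rw [hvq, hvq]
  exact sub_eq_zero.1 hqc ▸ hq.1

end TransportFlow

end ThreeSector

theorem proposition6 (v : Fin 3 → ThreeSector.Plane) (hv : AffineIndependent ℝ v) :
    (∃ X : ℝ → ThreeSector.Plane → ThreeSector.Plane, ThreeSector.IsLagrangianFlow v X) ∧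
    ∀ X : ℝ → ThreeSector.Plane → ThreeSector.Plane, ThreeSector.IsLagrangianFlow v X →
      List.TFAE
        [ThreeSector.center v hv ∈ convexHull ℝ (Set.range v),
          ∀ t : ℝ, 0 < t → ∀ x : ThreeSector.Plane,
            ThreeSector.V v (ThreeSector.center v hv) t x ∈
              ThreeSector.differential 0 (ThreeSector.u v t) x,
          ∀ t : ℝ, 0 ≤ t → ∀ y : ThreeSector.Plane, ThreeSector.T v t y = X t y,
          ThreeSector.IsSticky (ThreeSector.T v),
          ∀ t : ℝ, 0 < t →
            ThreeSector.OneSidedLipschitz (ThreeSector.V v (ThreeSector.center v hv) t)] := by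
  have hc := ThreeSector.dist_center_eq hv
  refine ⟨ThreeSector.exists_isLagrangianFlow v, fun X hX => ?_⟩
  tfae_have 1 → 2 := fun h t ht => ThreeSector.V_mem_differential hv hc h ht
  tfae_have 2 → 5 := fun h t ht => ThreeSector.oneSidedLipschitz_of_mem_differential (h t ht)
  tfae_have 5 → 1 := fun h =>
    ThreeSector.mem_convexHull_of_oneSidedLipschitz_V hv hc one_pos (h 1 one_pos)
  tfae_have 1 → 3 := fun h t ht => ThreeSector.T_eq_of_mem_convexHull hv hc h hX ht
  tfae_have 3 → 4 := fun h s t hs hst y z hyz => by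
    rw [h s hs, h s hs] at hyz
    rw [h t (hs.trans hst), h t (hs.trans hst)]
    exact hX.isSticky s t hs hst y z hyz
  tfae_have 4 → 1 := ThreeSector.mem_convexHull_of_isSticky_T hv hc
  tfae_finish
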